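/- Let $K$ be an algebraically closed field, let $Q$ be a finite connected quiver which is biserial (at each vertex at most two arrows start and at most two arrows end), and let $I$ be an admissible ideal of the path algebra $KQ$, i.e. $R^m\subseteq I\subseteq R^2$ for some $m\ge 2$, where $R$ is the ideal generated by the arrows. Assume that the algebra $\Lambda=KQ/I$ is tame, symmetric, and periodic of period four, i.e. $4$ is the smallest integer $d\ge 1$ with $\Omega^d_{\Lambda^e}(\Lambda)\cong\Lambda$ as $\Lambda$-bimodules. Paths are composed from left to right. For a path $p$ write $p\prec I$ if $p$ occurs with non-zero coefficient in some minimal relation of $I$, i.e. in some element of $e_aIe_b\setminus(RI+IR)$ with $a,b$ vertices. A vertex $i$ is regular if the number of arrows ending at $i$ equals the number of arrows starting at $i$ and this number is $1$ or $2$; otherwise it is non-regular. A $(1,2)$-vertex is a vertex at which exactly one arrow $\alpha$ ends and exactly two arrows $\beta,\bar\beta$ start; it is of type R if $\alpha\beta\prec I$ and $\alpha\bar\beta\prec I$, and proper if $\beta$ and $\bar\beta$ have distinct targets. Dually, a $(2,1)$-vertex is a vertex at which exactly two arrows $\alpha,\alpha^*$ end and exactly one arrow $\beta$ starts; it is of type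 R if $\alpha\beta\prec I$ and $\alpha^*\beta\prec I$, and proper if $\alpha$ and $\alpha^*$ have distinct sources. Then $Q$ has no proper non-regular vertex of type R; that is, no $(1,2)$-vertex and no $(2,1)$-vertex of $Q$ is both proper and of type R. -/

import Mathlib

open Quiver TensorProduct

universe u v w

/-! ### The path algebra of a finite quiver -/

/-- The type of all paths (of any length, including the trivial ones) of a quiver. -/
abbrev Quiver.AnyPath (V : Type v) [Quiver.{w} V] : Type (max v w) :=
  Σ a b : V, Quiver.Path a b

/-- The path algebra `KQ`: the vector space with basis all paths of `Q`. -/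
def PathAlgebra (K : Type u) (V : Type v) [Field K] [Quiver.{w} V] : Type (max u v w) :=
  Quiver.AnyPath V →₀ K

noncomputable section

namespace PathAlgebra

variable {K : Type u} {V : Type v} [Field K] [Quiver.{w} V]

instance : AddCommGroup (PathAlgebra K V) :=
  inferInstanceAs (AddCommGroup (Quiver.AnyPath V →₀ K))

instance : Module K (PathAlgebra K V) :=
  inferInstanceAs (Module K (Quiver.AnyPath V →₀ K))

/-- The coefficient of a path in an element of the path algebra. -/
def coeff (x : PathAlgebra K V) (p : Quiver.AnyPath V) : K :=
  (show Quiver.AnyPath V →₀ K from x) p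

/-- A path as an element of the path algebra. -/
def ofPath (K : Type u) {V : Type v} [Field K] [Quiver.{w} V] {a b : V} (p : Quiver.Path a b) :
    PathAlgebra K V :=
  (Finsupp.single ⟨a, b, p⟩ 1 : Quiver.AnyPath V →₀ K)

open Classical in
/-- The product of two paths: their concatenation (first `p`, then `q`) if the target of `p` is the
source of `q`, and zero otherwise. -/
def pathMul (K : Type u) {V : Type v} [Field K] [Quiver.{w} V] (p q : Quiver.AnyPath V) :
    PathAlgebra K V :=
  if h : p.2.1 = q.1 then ofPath K ((p.2.2.cast rfl h).comp q.2.2) else 0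

/-- The bilinear extension of the product of paths. -/
def mulHom (K : Type u) (V : Type v) [Field K] [Quiver.{w} V] :
    PathAlgebra K V →ₗ[K] PathAlgebra K V →ₗ[K] PathAlgebra K V :=
  Finsupp.linearCombination K (M := PathAlgebra K V →ₗ[K] PathAlgebra K V)
    (fun p : Quiver.AnyPath V =>
      (Finsupp.linearCombination K (M := PathAlgebra K V) (pathMul K p)))

theorem mulHom_ofPath {a b c d : V} (p : Quiver.Path a b) (q : Quiver.Path c d) :
    mulHom K V (ofPath K p) (ofPath K q) = pathMul K ⟨a, b, p⟩ ⟨c, d, q⟩ := by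
  have h1 : mulHom K V (ofPath K p) =
      Finsupp.linearCombination K (M := PathAlgebra K V) (pathMul K ⟨a, b, p⟩) :=
    (Finsupp.linearCombination_single K 1 _).trans (one_smul K _)
  rw [h1]
  exact (Finsupp.linearCombination_single K 1 _).trans (one_smul K _)

theorem mulHom_comp {a b c : V} (p : Quiver.Path a b) (q : Quiver.Path b c) :
    mulHom K V (ofPath K p) (ofPath K q) = ofPath K (p.comp q) := by
  rw [mulHom_ofPath, pathMul, dif_pos rfl]; rfl

theorem mulHom_ne {a b c d : V} (p : Quiver.Path a b) (q : Quiver.Path c d) (h : b ≠ c) :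
    mulHom K V (ofPath K p) (ofPath K q) = 0 := by
  rw [mulHom_ofPath, pathMul, dif_neg h]

theorem induction_on {motive : PathAlgebra K V → Prop} (x : PathAlgebra K V)
    (zero : motive 0) (add : ∀ x y, motive x → motive y → motive (x + y))
    (smul : ∀ (k : K) {a b : V} (p : Quiver.Path a b), motive (k • ofPath K p)) : motive x := by
  refine Finsupp.induction_linear (motive := motive) x zero (fun f g hf hg => add f g hf hg) ?_
  rintro ⟨a, b, p⟩ k
  have := smul k p
  have e : (k • ofPath K p : PathAlgebra K V) =
      (Finsupp.single ⟨a, b, p⟩ k : Quiver.AnyPath V →₀ K) :=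
    (Finsupp.smul_single k _ (1 : K)).trans (by rw [smul_eq_mul, mul_one])
  rwa [e] at this

theorem mulHom_assoc (x y z : PathAlgebra K V) :
    mulHom K V (mulHom K V x y) z = mulHom K V x (mulHom K V y z) := by
  induction x using induction_on with
  | zero => simp
  | add x x' hx hx' => simp only [map_add, LinearMap.add_apply, hx, hx']
  | smul k p =>
    induction y using induction_on with
    | zero => simp
    | add y y' hy hy' => simp only [map_add, LinearMap.add_apply, hy, hy']
    | smul l q =>
      induction z using induction_on with
      | zero => simp
      | add z z' hz hz' => simp only [map_add, hz, hz']
      | smul m r =>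
        rename_i a b c d e f
        simp only [map_smul, LinearMap.smul_apply]
        congr 3
        by_cases h : b = c
        · subst h
          by_cases h' : d = e
          · subst h'
            simp only [mulHom_comp, Quiver.Path.comp_assoc]
          · simp only [mulHom_comp, mulHom_ne _ _ h', map_zero]
        · by_cases h' : d = e
          · subst h'
            simp only [mulHom_comp, mulHom_ne _ _ h, map_zero, LinearMap.zero_apply]
          · simp only [mulHom_ne _ _ h, mulHom_ne _ _ h', map_zero, LinearMap.zero_apply]

/-- The trivial path at a vertex `a`, as an idempotent of the path algebra. -/
def vertexIdem (K : Type u) {V : Type v} [Field K] [Quiver.{w} V] (a : V) : PathAlgebra K V :=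
  ofPath K (Quiver.Path.nil : Quiver.Path a a)

variable [Fintype V]

theorem sum_vertexIdem_mul (x : PathAlgebra K V) :
    mulHom K V (∑ a : V, vertexIdem K a) x = x := by
  induction x using induction_on with
  | zero => simp
  | add x y hx hy => rw [map_add, hx, hy]
  | smul k p =>
    rename_i a b
    rw [map_smul, map_sum, LinearMap.sum_apply, Finset.sum_eq_single a]
    · rw [vertexIdem, mulHom_comp, Quiver.Path.nil_comp]
    · intro c _ hc
      exact mulHom_ne _ _ hc
    · intro h
      exact absurd (Finset.mem_univ a) h

theorem mul_sum_vertexIdem (x : PathAlgebra K V) :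
    mulHom K V x (∑ a : V, vertexIdem K a) = x := by
  induction x using induction_on with
  | zero => simp
  | add x y hx hy => rw [map_add, LinearMap.add_apply, hx, hy]
  | smul k p =>
    rename_i a b
    rw [map_smul, LinearMap.smul_apply, map_sum, Finset.sum_eq_single b]
    · rw [vertexIdem, mulHom_comp, Quiver.Path.comp_nil]
    · intro c _ hc
      exact mulHom_ne _ _ (Ne.symm hc)
    · intro h
      exact absurd (Finset.mem_univ b) h

instance : Ring (PathAlgebra K V) where
  __ := (inferInstance : AddCommGroup (PathAlgebra K V))
  mul x y := mulHom K V x y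
  one := ∑ a : V, vertexIdem K a
  left_distrib x y z := map_add (mulHom K V x) y z
  right_distrib x y z := by
    change mulHom K V (x + y) z = mulHom K V x z + mulHom K V y z
    rw [map_add, LinearMap.add_apply]
  zero_mul x := by
    change mulHom K V 0 x = 0
    rw [map_zero, LinearMap.zero_apply]
  mul_zero x := map_zero (mulHom K V x)
  mul_assoc := mulHom_assoc
  one_mul := sum_vertexIdem_mul
  mul_one := mul_sum_vertexIdem

instance : Algebra K (PathAlgebra K V) :=
  Algebra.ofModule
    (fun k x y => by
      change mulHom K V (k • x) y = k • mulHom K V x y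
      rw [map_smul, LinearMap.smul_apply])
    (fun k x y => map_smul (mulHom K V x) k y)

/-- The arrow ideal of the path algebra: the span of all paths of length at least one. -/
def arrowIdeal (K : Type u) (V : Type v) [Field K] [Quiver.{w} V] :
    Submodule K (PathAlgebra K V) :=
  Submodule.span K {x | ∃ (a b : V) (p : Quiver.Path a b), 1 ≤ p.length ∧ x = ofPath K p}

/-- An ideal `I` of `KQ` is admissible if `R ^ m ⊆ I ⊆ R ^ 2` for some `m ≥ 2`, where `R` is the
arrow ideal. -/
def IsAdmissible (I : Ideal (PathAlgebra K V)) : Prop :=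
  ∃ m : ℕ, 2 ≤ m ∧ arrowIdeal K V ^ m ≤ I.restrictScalars K ∧
    I.restrictScalars K ≤ arrowIdeal K V ^ 2

/-- A minimal relation of `I`: an element of `e_a I e_b`, for some vertices `a` and `b`, which does
not lie in `R I + I R`, where `R` is the arrow ideal (so that it is a minimal generator of `I`). -/
def IsMinimalRelation (I : Ideal (PathAlgebra K V)) (ρ : PathAlgebra K V) : Prop :=
  ρ ∈ I ∧ (∃ a b : V, vertexIdem K a * ρ * vertexIdem K b = ρ) ∧
    ρ ∉ arrowIdeal K V * I.restrictScalars K + I.restrictScalars K * arrowIdeal K V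

/-- The relation `p ≺ I`: the path `p` occurs, with non-zero coefficient, in some minimal relation
of `I`. -/
def OccursIn {a b : V} (p : Quiver.Path a b) (I : Ideal (PathAlgebra K V)) : Prop :=
  ∃ ρ : PathAlgebra K V, IsMinimalRelation I ρ ∧ ρ.coeff ⟨a, b, p⟩ ≠ 0

end PathAlgebra

/-! ### Symmetric algebras -/

/-- A symmetric algebra: there is a non-degenerate, symmetric, associative bilinear form. -/
def IsSymmAlgebra (K : Type u) (A : Type v) [Field K] [Ring A] [Algebra K A] : Prop :=
  ∃ B : LinearMap.BilinForm K A, B.Nondegenerate ∧ (∀ x y : A, B x y = B y x) ∧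
    ∀ x y z : A, B (x * y) z = B x (y * z)

/-! ### Syzygies and periodic algebras -/

/-- `N` is the syzygy `Ω(M)`: it is isomorphic to the kernel of a projective cover `π : P → M`,
that is, of an epimorphism from a (finitely generated) projective module with superfluous kernel. -/
def IsSyzygy {R : Type u} [Ring R] (M N : ModuleCat.{v} R) : Prop :=
  ∃ (P : ModuleCat.{v} R) (π : P →ₗ[R] M), Module.Projective R P ∧ Module.Finite R P ∧
    Function.Surjective π ∧
    (∀ U : Submodule R P, LinearMap.ker π ⊔ U = ⊤ → U = ⊤) ∧
    Nonempty (N ≃ₗ[R] LinearMap.ker π)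

/-- `N` is the iterated syzygy `Ω^n(M)`. -/
def IsIteratedSyzygy {R : Type u} [Ring R] : ℕ → ModuleCat.{v} R → ModuleCat.{v} R → Prop
  | 0, M, N => Nonempty (N ≃ₗ[R] M)
  | n + 1, M, N => ∃ L : ModuleCat.{v} R, IsSyzygy M L ∧ IsIteratedSyzygy n L N

/-- `M` is a periodic module of period `d`: `d` is the smallest positive integer with
`Ω^d(M) ≅ M`. -/
def HasPeriod {R : Type u} [Ring R] (M : ModuleCat.{v} R) (d : ℕ) : Prop :=
  IsLeast {n : ℕ | 1 ≤ n ∧ IsIteratedSyzygy n M M} d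

/-- The algebra `A` as a module over its enveloping algebra, `(a ⊗ b) x = a x b`. -/
def regularBimodule (K : Type u) (A : Type v) [Field K] [Ring A] [Algebra K A] :
    ModuleCat.{v} (A ⊗[K] Aᵐᵒᵖ) :=
  letI : Module (A ⊗[K] Aᵐᵒᵖ) A := TensorProduct.Algebra.module
  ModuleCat.of (A ⊗[K] Aᵐᵒᵖ) A

/-- `A` is a periodic algebra of period `d`: it is periodic of period `d` as a bimodule. -/
def IsPeriodicAlgebra (K : Type u) (A : Type v) [Field K] [Ring A] [Algebra K A] (d : ℕ) : Prop :=
  HasPeriod (regularBimodule K A) d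

/-! ### Tame algebras -/

/-- An indecomposable module. -/
def IsIndecomposableModule (R : Type u) (M : Type v) [Ring R] [AddCommGroup M] [Module R M] :
    Prop :=
  Nontrivial M ∧ ∀ U W : Submodule R M, IsCompl U W → U = ⊥ ∨ W = ⊥

/-- A `K[X]`-`A`-bimodule (on which `K` acts centrally) which is free of finite rank as a left
`K[X]`-module. -/
structure OneParameterFamily (K : Type u) (A : Type v) [Field K] [Ring A] [Algebra K A] where
  carrier : Type u
  [addCommGroup : AddCommGroup carrier]
  [polyModule : Module (Polynomial K) carrier]
  [rightModule : Module Aᵐᵒᵖ carrier]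
  [smulComm : SMulCommClass (Polynomial K) Aᵐᵒᵖ carrier]
  central : ∀ (c : K) (x : carrier),
    (Polynomial.C c : Polynomial K) • x = (algebraMap K Aᵐᵒᵖ c) • x
  [free : Module.Free (Polynomial K) carrier]
  [finite : Module.Finite (Polynomial K) carrier]

attribute [instance] OneParameterFamily.addCommGroup OneParameterFamily.polyModule
  OneParameterFamily.rightModule OneParameterFamily.smulComm

/-- The right `A`-module `K[X]/(X - c) ⊗ N` of a one-parameter family `N` (tensor product over
`K[X]`, written with the factors exchanged). -/
abbrev OneParameterFamily.specialization {K : Type u} {A : Type v} [Field K] [Ring A] [Algebra K A]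
    (N : OneParameterFamily K A) (c : K) : Type u :=
  N.carrier ⊗[Polynomial K]
    (Polynomial K ⧸ Ideal.span {(Polynomial.X - Polynomial.C c : Polynomial K)})

/-- A tame algebra: for each dimension `d`, all but finitely many isomorphism classes of
indecomposable right modules of dimension `d` are obtained by specialization from finitely many
one-parameter families. (Every finite-dimensional module has a copy in the universe of `K`.) -/
def IsTameAlgebra (K : Type u) (A : Type v) [Field K] [Ring A] [Algebra K A] : Prop :=
  ∀ d : ℕ, 1 ≤ d → ∃ (n : ℕ) (N : Fin n → OneParameterFamily K A)
    (m : ℕ) (E : Fin m → ModuleCat.{u} Aᵐᵒᵖ),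
    ∀ (M : Type u) [AddCommGroup M] [Module K M] [Module Aᵐᵒᵖ M] [IsScalarTower K Aᵐᵒᵖ M],
      IsIndecomposableModule Aᵐᵒᵖ M → Module.finrank K M = d →
        (∃ i : Fin m, Nonempty (M ≃ₗ[Aᵐᵒᵖ] E i)) ∨
        (∃ (i : Fin n) (c : K), Nonempty (M ≃ₗ[Aᵐᵒᵖ] (N i).specialization c))

end

/-! ### Vertices of quivers -/

namespace Quiver

variable {V : Type v} [Quiver.{w} V]

/-- A connected quiver: any two vertices are joined by a walk of unoriented arrows. -/
def IsConnectedQuiver (V : Type v) [Quiver.{w} V] : Prop :=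
  Nonempty V ∧ Subsingleton (WeaklyConnectedComponent V)

/-- A biserial quiver: at each vertex at most two arrows start and at most two arrows end. -/
def IsBiserial (V : Type v) [Quiver.{w} V] : Prop :=
  ∀ i : V, Nat.card (Star i) ≤ 2 ∧ Nat.card (Costar i) ≤ 2

/-- A regular vertex: one arrow starts and one ends at it, or two start and two end. -/
def IsRegularVertex (i : V) : Prop :=
  Nat.card (Costar i) = Nat.card (Star i) ∧ (Nat.card (Star i) = 1 ∨ Nat.card (Star i) = 2)

/-- A `(1,2)`-vertex: one arrow ends and two arrows start at it. -/
def IsOneTwoVertex (i : V) : Prop := Nat.card (Costar i) = 1 ∧ Nat.card (Star i) = 2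

/-- A `(2,1)`-vertex: two arrows end and one arrow starts at it. -/
def IsTwoOneVertex (i : V) : Prop := Nat.card (Costar i) = 2 ∧ Nat.card (Star i) = 1

/-- A proper `(1,2)`-vertex (`(2,1)`-vertex): the two arrows which start (end) at it have distinct
targets (sources). -/
def IsProperVertex (i : V) : Prop :=
  (IsOneTwoVertex i ∧ ∀ β β' : Star i, β ≠ β' → β.1 ≠ β'.1) ∨
    (IsTwoOneVertex i ∧ ∀ α α' : Costar i, α ≠ α' → α.1 ≠ α'.1)

/-- A `(1,2)`- or `(2,1)`-vertex `i` is of type R if both paths `αβ` of length two through `i`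
satisfy `αβ ≺ I`. -/
def IsTypeR {K : Type u} [Field K] [Fintype V] (I : Ideal (PathAlgebra K V)) (i : V) : Prop :=
  (IsOneTwoVertex i ∨ IsTwoOneVertex i) ∧
    ∀ (α : Costar i) (β : Star i), PathAlgebra.OccursIn (α.2.toPath.comp β.2.toPath) I

end Quiver

/-! Let `A` be the algebra and work with left modules, so that `A e_a` is spanned by the paths
ending at `a`. Tensoring a bimodule resolution of `A` on the right with the simple module `S_a`,
period four gives an exact sequence from `S_a` to `S_a` with four projective middle terms. Hence
`Ω²(S_a)` and `Ω⁻²(S_a)` agree up to projective summands. The arrows `f` ending at `a` present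
`S_a`; since `A` is symmetric, right multiplication by the arrows `g` starting at `a` copresents it.
Comparison yields a matrix with entries `φ g f` in `e_{t(g)} A e_{s(f)}` such that `∑_f φ g f · f =
0`, `∑_g g · φ g f = 0`, and the rows generate all left relations between the arrows ending at `a`
(`exists_syzygy_matrix`, `exists_isRelationMatrix`). Only a retract in the stable category is needed
for this, which avoids cancelling projective summands.

Let `α : j ⟶ i` be the only arrow ending at `i`, and let `β : i ⟶ k`, `β' : i ⟶ l` with `k ≠ l`. If
`αβ` occurs in a relation, then in the matrix at `k` some entry of the column `β`, in a row `δ : k ⟶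
j`, contains `α` linearly. All entries of that column are left multiples of `α`, so the column
relation reads `w α = 0`, with `w` equal to a nonzero multiple of `δ` plus other terms. Likewise
`αβ'` gives `δ' : l ⟶ j` and `w'`. At most two arrows end at `j`, so these are all of them, and
nilpotency of the radical gives `rad · α = 0`. A symmetric algebra has no such arrow between
distinct vertices (`not_occurs_oneTwo`).

For a `(2,1)`-vertex `i` with outgoing arrow `β : i ⟶ j`, the column `β` of the matrix at `j` is
rewritten as a relation at `i`. The matrix at `i` has one row, its entries are killed by `β` on the
left, and they are perturbations of the arrows starting at `j`; hence `β · rad = 0`, which is again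
impossible (`not_occurs_twoOne`). -/

/-! ### Stable retracts -/

section StableRetract

variable {R : Type u} [Ring R]

/-- A module which is a direct summand of a finite free module. -/
def IsFiniteFreeRetract (R : Type u) [Ring R] (Q : Type v) [AddCommGroup Q] [Module R Q] : Prop :=
  ∃ (ι : Type) (_ : Finite ι) (s : Q →ₗ[R] (ι → R)) (t : (ι → R) →ₗ[R] Q), ∀ x, t (s x) = x

/-- `M` is a retract of `M'` in the stable category: the identity of `M` is the sum of a map
through `M'` and a map through a finite free module. -/
def IsStableRetract (R : Type u) [Ring R] (M : Type v) (M' : Type w) [AddCommGroup M]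
    [AddCommGroup M'] [Module R M] [Module R M'] : Prop :=
  ∃ (f : M →ₗ[R] M') (g : M' →ₗ[R] M) (ι : Type) (_ : Finite ι) (s : M →ₗ[R] (ι → R))
    (t : (ι → R) →ₗ[R] M), ∀ x, g (f x) + t (s x) = x

theorem IsFiniteFreeRetract.projective {Q : Type v} [AddCommGroup Q] [Module R Q]
    (h : IsFiniteFreeRetract R Q) : Module.Projective R Q := by
  obtain ⟨ι, _, s, t, hst⟩ := h
  exact Module.Projective.of_split s t (LinearMap.ext hst)

/-- Self-injectivity extends each coordinate of the composite into the free module; the retraction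
then returns to `Q`. -/
theorem IsFiniteFreeRetract.extend (hR : Module.Injective R R) {Q X Y : Type u} [AddCommGroup Q]
    [Module R Q] [AddCommGroup X] [Module R X] [AddCommGroup Y] [Module R Y]
    (h : IsFiniteFreeRetract R Q) (i : X →ₗ[R] Y) (hi : Function.Injective i) (f : X →ₗ[R] Q) :
    ∃ g : Y →ₗ[R] Q, ∀ x, g (i x) = f x := by
  obtain ⟨ι, _, s, t, hst⟩ := h
  choose g hg using fun k : ι => hR.out i hi ((LinearMap.proj k).comp (s.comp f))
  refine ⟨t.comp (LinearMap.pi g), fun x => ?_⟩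
  have : LinearMap.pi g (i x) = s (f x) := by
    ext k
    exact hg k x
  rw [LinearMap.comp_apply, this, hst]

theorem IsStableRetract.refl (M : Type v) [AddCommGroup M] [Module R M] :
    IsStableRetract R M M :=
  ⟨LinearMap.id, LinearMap.id, PEmpty, inferInstance, 0, 0, fun x => by simp⟩

theorem IsStableRetract.trans {M₁ M₂ M₃ : Type*} [AddCommGroup M₁] [AddCommGroup M₂]
    [AddCommGroup M₃] [Module R M₁] [Module R M₂] [Module R M₃] (h : IsStableRetract R M₁ M₂)
    (h' : IsStableRetract R M₂ M₃) : IsStableRetract R M₁ M₃ := by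
  obtain ⟨f, g, ι, _, s, t, hst⟩ := h
  obtain ⟨f', g', ι', _, s', t', hst'⟩ := h'
  refine ⟨f'.comp f, g.comp g', ι ⊕ ι', inferInstance,
    (LinearEquiv.sumArrowLequivProdArrow ι ι' R R).symm.toLinearMap.comp (s.prod (s'.comp f)),
    (t.coprod (g.comp t')).comp (LinearEquiv.sumArrowLequivProdArrow ι ι' R R).toLinearMap,
    fun x => ?_⟩
  have h1 := congrArg g (hst' (f x))
  rw [map_add] at h1
  simp only [LinearMap.comp_apply, LinearEquiv.coe_coe, LinearEquiv.apply_symm_apply,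
    LinearMap.prod_apply, Function.prod, LinearMap.coprod_apply]
  rw [add_comm (t _), ← add_assoc, h1, hst]

theorem exists_factor_through_injective {X Y Z : Type*} [AddCommGroup X] [AddCommGroup Y]
    [AddCommGroup Z] [Module R X] [Module R Y] [Module R Z] (i : Y →ₗ[R] Z)
    (hi : Function.Injective i) (h : X →ₗ[R] Z) (hh : ∀ x, ∃ y, i y = h x) :
    ∃ k : X →ₗ[R] Y, ∀ x, i (k x) = h x := by
  choose k hk using hh
  refine ⟨{ toFun := k, map_add' := fun x y => hi ?_, map_smul' := fun r x => hi ?_ }, hk⟩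
  · rw [map_add, hk, hk, hk, map_add]
  · rw [RingHom.id_apply, map_smul, hk, hk, map_smul]

theorem exists_factor_through_surjective {X Y Z : Type*} [AddCommGroup X] [AddCommGroup Y]
    [AddCommGroup Z] [Module R X] [Module R Y] [Module R Z] (p : X →ₗ[R] Y)
    (hp : Function.Surjective p) (h : X →ₗ[R] Z) (hh : ∀ x, p x = 0 → h x = 0) :
    ∃ k : Y →ₗ[R] Z, ∀ x, k (p x) = h x := by
  have key : ∀ x x', p x = p x' → h x = h x' := fun x x' e => by
    rw [← sub_eq_zero, ← map_sub]
    exact hh _ (by rw [map_sub, e, sub_self])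
  choose σ hσ using hp
  refine ⟨{ toFun := fun y => h (σ y), map_add' := fun x y => ?_, map_smul' := fun r x => ?_ },
    fun x => key _ _ (hσ _)⟩
  · rw [← map_add]
    exact key _ _ (by rw [map_add, hσ, hσ, hσ])
  · rw [RingHom.id_apply, ← map_smul]
    exact key _ _ (by rw [map_smul, hσ, hσ])

/-- Syzygies preserve stable retracts. -/
theorem IsStableRetract.syzygy {N₁ P₁ M₁ N₂ P₂ M₂ : Type*} [AddCommGroup N₁] [AddCommGroup P₁]
    [AddCommGroup M₁] [AddCommGroup N₂] [AddCommGroup P₂] [AddCommGroup M₂] [Module R N₁]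
    [Module R P₁] [Module R M₁] [Module R N₂] [Module R P₂] [Module R M₂]
    (h : IsStableRetract R M₁ M₂)
    {i₁ : N₁ →ₗ[R] P₁} {p₁ : P₁ →ₗ[R] M₁} (hi₁ : Function.Injective i₁)
    (hp₁ : Function.Surjective p₁) (e₁ : Function.Exact i₁ p₁) (hP₁ : IsFiniteFreeRetract R P₁)
    {i₂ : N₂ →ₗ[R] P₂} {p₂ : P₂ →ₗ[R] M₂} (hi₂ : Function.Injective i₂)
    (hp₂ : Function.Surjective p₂) (e₂ : Function.Exact i₂ p₂) (hP₂ : IsFiniteFreeRetract R P₂) :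
    IsStableRetract R N₁ N₂ := by
  obtain ⟨f, g, ι, _, s, t, hst⟩ := h
  have := hP₁.projective
  have := hP₂.projective
  obtain ⟨F, hF⟩ := Module.projective_lifting_property p₂ (f.comp p₁) hp₂
  obtain ⟨G, hG⟩ := Module.projective_lifting_property p₁ (g.comp p₂) hp₁
  obtain ⟨T, hT⟩ := Module.projective_lifting_property p₁ t hp₁
  replace hF := fun x => LinearMap.congr_fun hF x
  replace hG := fun x => LinearMap.congr_fun hG x
  replace hT := fun x => LinearMap.congr_fun hT x
  simp only [LinearMap.comp_apply] at hF hG hT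
  obtain ⟨f', hf'⟩ := exists_factor_through_injective i₂ hi₂ (F.comp i₁) fun x =>
    (e₂ _).1 (by rw [LinearMap.comp_apply, hF, e₁.apply_apply_eq_zero, map_zero])
  obtain ⟨g', hg'⟩ := exists_factor_through_injective i₁ hi₁ (G.comp i₂) fun x =>
    (e₁ _).1 (by rw [LinearMap.comp_apply, hG, e₂.apply_apply_eq_zero, map_zero])
  -- After lifting to the projectives, the identity `g f + t s = 1` only says that this difference
  -- has image in `N₁`. On `N₁` the term with `s ∘ p₁` vanishes, so the defect of `g' f'` from the
  -- identity is `θ ∘ i₁`, which factors through `P₁`.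
  obtain ⟨θ, hθ⟩ := exists_factor_through_injective i₁ hi₁
    (LinearMap.id - G.comp F - T.comp (s.comp p₁)) fun x => (e₁ _).1 (by
      simp only [LinearMap.sub_apply, LinearMap.id_apply, LinearMap.comp_apply, map_sub, hG, hF, hT]
      nth_rewrite 1 [← hst (p₁ x)]
      abel)
  obtain ⟨κ, _, a, b, hab⟩ := hP₁
  refine ⟨f', g', κ, inferInstance, a.comp i₁, θ.comp b, fun x => hi₁ ?_⟩
  simp only [LinearMap.comp_apply, LinearMap.sub_apply, LinearMap.id_apply] at hf' hg' hθ ⊢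
  rw [map_add, hg', hf', hab, hθ, e₁.apply_apply_eq_zero, map_zero, map_zero]
  abel

/-- Over a self-injective ring, cosyzygies preserve stable retracts. -/
theorem IsStableRetract.cosyzygy (hR : Module.Injective R R) {N₁ P₁ M₁ N₂ P₂ M₂ : Type u}
    [AddCommGroup N₁] [AddCommGroup P₁]
    [AddCommGroup M₁] [AddCommGroup N₂] [AddCommGroup P₂] [AddCommGroup M₂] [Module R N₁]
    [Module R P₁] [Module R M₁] [Module R N₂] [Module R P₂] [Module R M₂]
    (h : IsStableRetract R N₁ N₂)
    {i₁ : N₁ →ₗ[R] P₁} {p₁ : P₁ →ₗ[R] M₁} (hi₁ : Function.Injective i₁)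
    (hp₁ : Function.Surjective p₁) (e₁ : Function.Exact i₁ p₁) (hP₁ : IsFiniteFreeRetract R P₁)
    {i₂ : N₂ →ₗ[R] P₂} {p₂ : P₂ →ₗ[R] M₂} (hi₂ : Function.Injective i₂)
    (hp₂ : Function.Surjective p₂) (e₂ : Function.Exact i₂ p₂) (hP₂ : IsFiniteFreeRetract R P₂) :
    IsStableRetract R M₁ M₂ := by
  obtain ⟨f, g, ι, _, s, t, hst⟩ := h
  obtain ⟨F, hF⟩ := hP₂.extend hR i₁ hi₁ (i₂.comp f)
  obtain ⟨G, hG⟩ := hP₁.extend hR i₂ hi₂ (i₁.comp g)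
  obtain ⟨S, hS⟩ := IsFiniteFreeRetract.extend hR
    ⟨ι, inferInstance, LinearMap.id, LinearMap.id, fun _ => rfl⟩ i₁ hi₁ s
  simp only [LinearMap.comp_apply] at hF hG
  obtain ⟨f', hf'⟩ := exists_factor_through_surjective p₁ hp₁ (p₂.comp F) fun x hx => by
    obtain ⟨y, rfl⟩ := (e₁ _).1 hx
    rw [LinearMap.comp_apply, hF, e₂.apply_apply_eq_zero]
  obtain ⟨g', hg'⟩ := exists_factor_through_surjective p₂ hp₂ (p₁.comp G) fun x hx => by
    obtain ⟨y, rfl⟩ := (e₂ _).1 hx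
    rw [LinearMap.comp_apply, hG, e₁.apply_apply_eq_zero]
  -- Dually, the difference vanishes on `N₁` and so descends to `M₁`; the defect of `g' f'` from the
  -- identity is `p₁ ∘ θ`.
  obtain ⟨θ, hθ⟩ := exists_factor_through_surjective p₁ hp₁
    (LinearMap.id - G.comp F - i₁.comp (t.comp S)) fun x hx => by
      obtain ⟨y, rfl⟩ := (e₁ _).1 hx
      simp only [LinearMap.sub_apply, LinearMap.id_apply, LinearMap.comp_apply, hG, hF, hS]
      nth_rewrite 1 [← hst y]
      rw [map_add]
      abel
  obtain ⟨κ, _, a, b, hab⟩ := hP₁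
  refine ⟨f', g', κ, inferInstance, a.comp θ, p₁.comp b, fun x => ?_⟩
  obtain ⟨y, rfl⟩ := hp₁ x
  simp only [LinearMap.comp_apply, LinearMap.sub_apply, LinearMap.id_apply] at hf' hg' hθ ⊢
  rw [hf', hg', hab, hθ, map_sub, map_sub, e₁.apply_apply_eq_zero]
  abel

/-! ### From stable retracts to surjections. -/

theorem eq_top_of_sup_smul_eq_top {M : Type*} [AddCommGroup M] [Module R M] (J : Ideal R)
    [J.IsTwoSided] {n : ℕ} (hJ : J ^ n = ⊥) (U : Submodule R M) (hU : U ⊔ J • ⊤ = ⊤) : U = ⊤ := by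
  -- Nakayama for a nilpotent ideal: substituting `M = U + J M` into itself pushes the remainder
  -- into higher powers of `J`.
  have key : ∀ k : ℕ, U ⊔ (J ^ k) • (⊤ : Submodule R M) = ⊤ := by
    intro k
    induction k with
    | zero => rw [Submodule.pow_zero, Ideal.one_eq_top, Submodule.top_smul, sup_top_eq]
    | succ k ih =>
      have h1 : (J ^ k) • (⊤ : Submodule R M) ≤ U ⊔ (J ^ (k + 1)) • (⊤ : Submodule R M) := by
        conv_lhs => rw [← hU]
        rw [Submodule.smul_sup]
        refine sup_le_sup Submodule.smul_le_right ?_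
        rw [Ideal.IsTwoSided.pow_add, Submodule.pow_one, Submodule.mul_smul]
      exact top_le_iff.1 (ih.symm.le.trans (sup_le le_sup_left h1))
  have := key n
  rwa [hJ, Submodule.bot_smul, sup_bot_eq] at this

/-- If a radical submodule `N` of a module is a stable retract of `M'`, then it is a quotient
of `M'`. -/
theorem IsStableRetract.exists_surjective (hR : Module.Injective R R) {N E M' : Type u}
    [AddCommGroup N] [AddCommGroup E] [AddCommGroup M'] [Module R N] [Module R E] [Module R M']
    (h : IsStableRetract R N M') (J : Ideal R) [J.IsTwoSided] {n : ℕ} (hJ : J ^ n = ⊥)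
    (i : N →ₗ[R] E) (hi : Function.Injective i) (hrad : ∀ x, i x ∈ J • (⊤ : Submodule R E)) :
    ∃ g : M' →ₗ[R] N, Function.Surjective g := by
  obtain ⟨f, g, ι, _, s, t, hst⟩ := h
  -- Extending `s` over `E` shows that `t ∘ s` maps `N ⊆ J E` into `J N`. Thus `N = g(M') + J N`.
  obtain ⟨S, hS⟩ := IsFiniteFreeRetract.extend hR
    ⟨ι, inferInstance, LinearMap.id, LinearMap.id, fun _ => rfl⟩ i hi s
  refine ⟨g, LinearMap.range_eq_top.1 (eq_top_of_sup_smul_eq_top J hJ _ (top_le_iff.1 ?_))⟩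
  intro x _
  rw [← hst x]
  refine add_mem (Submodule.mem_sup_left ⟨_, rfl⟩) (Submodule.mem_sup_right ?_)
  have h1 : t (s x) = (t.comp S) (i x) := by rw [LinearMap.comp_apply, hS]
  rw [h1]
  have h2 := Submodule.mem_map_of_mem (f := t.comp S) (hrad x)
  rw [Submodule.map_smul''] at h2
  exact Submodule.smul_mono le_rfl le_top h2

end StableRetract

/-! ### Reduction of bimodules along a character -/

section Reduction

variable {K : Type u} {A : Type v} [Field K] [Ring A] [Algebra K A]

/-! ### Bimodules that are projective on the right. -/

/-- The right multiplication by an element of the algebra on a bimodule. -/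
def rightMul {M : Type w} [AddCommGroup M] [Module (A ⊗[K] Aᵐᵒᵖ) M] (b : A) : M →+ M :=
  DistribSMul.toAddMonoidHom M ((1 : A) ⊗ₜ[K] MulOpposite.op b : A ⊗[K] Aᵐᵒᵖ)

section

variable {M : Type w} [AddCommGroup M] [Module (A ⊗[K] Aᵐᵒᵖ) M]

theorem rightMul_def (b : A) (x : M) :
    rightMul (K := K) b x = ((1 : A) ⊗ₜ[K] MulOpposite.op b : A ⊗[K] Aᵐᵒᵖ) • x := rfl

theorem rightMul_rightMul (b c : A) (x : M) :
    rightMul (K := K) c (rightMul (K := K) b x) = rightMul (K := K) (b * c) x := by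
  rw [rightMul_def, rightMul_def, rightMul_def, smul_smul, Algebra.TensorProduct.tmul_mul_tmul,
    mul_one, MulOpposite.op_mul]

theorem rightMul_add (b c : A) (x : M) :
    rightMul (K := K) (b + c) x = rightMul (K := K) b x + rightMul (K := K) c x := by
  simp only [rightMul_def, MulOpposite.op_add, TensorProduct.tmul_add, add_smul]

theorem rightMul_zero (x : M) : rightMul (K := K) (0 : A) x = 0 := by
  have h := rightMul_add (K := K) (0 : A) 0 x
  rwa [add_zero, left_eq_add] at h

theorem map_rightMul {M' : Type*} [AddCommGroup M'] [Module (A ⊗[K] Aᵐᵒᵖ) M']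
    (f : M →ₗ[A ⊗[K] Aᵐᵒᵖ] M') (b : A) (x : M) :
    f (rightMul (K := K) b x) = rightMul (K := K) b (f x) := map_smul f _ x

end

/-- A finite dual basis of a bimodule, as a right module. -/
def HasRightDualBasis (K : Type u) (A : Type v) [Field K] [Ring A] [Algebra K A]
    (M : Type w) [AddCommGroup M] [Module (A ⊗[K] Aᵐᵒᵖ) M] : Prop :=
  ∃ (ι : Type) (_ : Fintype ι) (s : ι → M →+ A) (c : ι → M),
    (∀ i b x, s i (rightMul (K := K) b x) = s i x * b) ∧
    ∀ x, ∑ i, rightMul (K := K) (s i x) (c i) = x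

/-- A surjection of bimodules onto a bimodule with a right dual basis splits as a map of right
modules: there is a retraction onto its kernel. -/
theorem HasRightDualBasis.exists_retraction {L B C : Type*} [AddCommGroup L] [AddCommGroup B]
    [AddCommGroup C] [Module (A ⊗[K] Aᵐᵒᵖ) L] [Module (A ⊗[K] Aᵐᵒᵖ) B] [Module (A ⊗[K] Aᵐᵒᵖ) C]
    (hC : HasRightDualBasis K A C) {i : L →ₗ[A ⊗[K] Aᵐᵒᵖ] B} {p : B →ₗ[A ⊗[K] Aᵐᵒᵖ] C}
    (hi : Function.Injective i) (hp : Function.Surjective p) (e : Function.Exact i p) :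
    ∃ r : B →+ L, (∀ x, r (i x) = x) ∧
      ∀ (b : A) (x : B), r (rightMul (K := K) b x) = rightMul (K := K) b (r x) := by
  obtain ⟨ι, _, s, c, hs, hc⟩ := hC
  choose d hd using fun k => hp (c k)
  -- Sending `c k` to a lift `d k` defines a right-linear section of `p`; what remains after
  -- subtracting it lies in the image of `i`.
  have key : ∀ x, ∃ y, i y = x - ∑ k, rightMul (K := K) (s k (p x)) (d k) := fun x =>
    (e _).1 (by simp only [map_sub, map_sum, map_rightMul, hd, hc, sub_self])
  choose r hr using key
  have hadd : ∀ x y, r (x + y) = r x + r y := fun x y => hi (by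
    simp only [map_add, hr, rightMul_add, Finset.sum_add_distrib]
    abel)
  refine ⟨⟨⟨r, hi ?_⟩, hadd⟩, fun x => hi ?_, fun b x => hi ?_⟩
  · have := hadd 0 0
    rw [add_zero, left_eq_add] at this
    rw [this]
  · change i (r (i x)) = i x
    rw [hr, e.apply_apply_eq_zero]
    simp only [map_zero, rightMul_zero, Finset.sum_const_zero, sub_zero]
  · change i (r _) = i (rightMul (K := K) b (r x))
    rw [hr, map_rightMul, map_rightMul, hr, map_sub, map_sum]
    simp only [hs, rightMul_rightMul]

/-- The retraction makes `L` a right direct summand of `B`, so the generators of `B` can be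
projected to `L`. This carries right projectivity along a bimodule resolution. -/
theorem HasRightDualBasis.kernel {L B C : Type*} [AddCommGroup L] [AddCommGroup B]
    [AddCommGroup C] [Module (A ⊗[K] Aᵐᵒᵖ) L] [Module (A ⊗[K] Aᵐᵒᵖ) B] [Module (A ⊗[K] Aᵐᵒᵖ) C]
    (hB : HasRightDualBasis K A B)
    (hC : HasRightDualBasis K A C) {i : L →ₗ[A ⊗[K] Aᵐᵒᵖ] B} {p : B →ₗ[A ⊗[K] Aᵐᵒᵖ] C}
    (hi : Function.Injective i) (hp : Function.Surjective p) (e : Function.Exact i p) :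
    HasRightDualBasis K A L := by
  obtain ⟨r, hr, hr'⟩ := hC.exists_retraction hi hp e
  obtain ⟨ι, _, s, c, hs, hc⟩ := hB
  refine ⟨ι, inferInstance, fun k => (s k).comp i.toAddMonoidHom, fun k => r (c k),
    fun k b x => ?_, fun x => ?_⟩
  · change s k (i _) = s k (i x) * b
    rw [map_rightMul, hs]
  · have := congrArg r (hc (i x))
    rw [map_sum, hr] at this
    simp only [hr'] at this
    exact this

theorem exists_dual_basis_of_projective {R : Type*} [Ring R] (P : Type*) [AddCommGroup P]
    [Module R P] [Module.Projective R P] [Module.Finite R P] :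
    ∃ (n : ℕ) (s : P →ₗ[R] (Fin n → R)) (c : Fin n → P), ∀ x, ∑ i, s x i • c i = x := by
  obtain ⟨n, f, hf⟩ := Module.Finite.exists_fin' R P
  obtain ⟨s, hs⟩ := Module.projective_lifting_property f LinearMap.id hf
  refine ⟨n, s, fun i => f (Pi.single i 1), fun x => ?_⟩
  have h := LinearMap.congr_fun hs x
  rw [LinearMap.comp_apply, LinearMap.id_apply] at h
  conv_rhs => rw [← h, LinearMap.pi_apply_eq_sum_univ f (s x)]
  refine Finset.sum_congr rfl fun i _ => ?_
  beta_reduce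
  rw [show (Pi.single i 1 : Fin n → R) = fun j => if i = j then 1 else 0 from
    funext fun j => by simp [Pi.single_apply, eq_comm]]

/-- For a `K`-basis `b` of `A`, the enveloping algebra is free on the elements `b j ⊗ 1` as a right
module, with coordinates `ρ j : a ⊗ c ↦ (b j)^*(a) c`. Composing them with a dual basis of `P` over
the enveloping algebra gives the claim. -/
theorem HasRightDualBasis.of_projective [FiniteDimensional K A] (P : Type*) [AddCommGroup P]
    [Module (A ⊗[K] Aᵐᵒᵖ) P] [Module.Projective (A ⊗[K] Aᵐᵒᵖ) P]
    [Module.Finite (A ⊗[K] Aᵐᵒᵖ) P] : HasRightDualBasis K A P := by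
  obtain ⟨n, s, c, hc⟩ := exists_dual_basis_of_projective (R := A ⊗[K] Aᵐᵒᵖ) P
  let b := Module.finBasis K A
  let ρ : Fin (Module.finrank K A) → A ⊗[K] Aᵐᵒᵖ →ₗ[K] A := fun j =>
    TensorProduct.lift (((b.coord j).smulRight (LinearMap.id : A →ₗ[K] A)).compr₂ LinearMap.id
      |>.compl₁₂ LinearMap.id (MulOpposite.opLinearEquiv K).symm.toLinearMap)
  have hρ : ∀ j (a c : A), ρ j (a ⊗ₜ MulOpposite.op c) = b.coord j a • c := fun j a c => rfl
  have hρ' : ∀ j (r : A ⊗[K] Aᵐᵒᵖ) (c : A), ρ j ((1 : A) ⊗ₜ MulOpposite.op c * r) = ρ j r * c := by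
    intro j r c
    induction r using TensorProduct.induction_on with
    | zero => simp
    | add x y hx hy => rw [mul_add, map_add, hx, hy, map_add, add_mul]
    | tmul x y =>
      rw [Algebra.TensorProduct.tmul_mul_tmul, one_mul, ← MulOpposite.op_unop y,
        ← MulOpposite.op_mul, hρ, hρ, smul_mul_assoc]
  have hρs : ∀ r : A ⊗[K] Aᵐᵒᵖ,
      ∑ j, (1 : A) ⊗ₜ[K] MulOpposite.op (ρ j r) * (b j ⊗ₜ[K] (1 : Aᵐᵒᵖ)) = r := by
    intro r
    induction r using TensorProduct.induction_on with
    | zero => simp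
    | add x y hx hy =>
      simp only [map_add, MulOpposite.op_add, TensorProduct.tmul_add, add_mul,
        Finset.sum_add_distrib, hx, hy]
    | tmul x y =>
      obtain ⟨y, rfl⟩ := MulOpposite.op_surjective y
      conv_rhs => rw [← b.sum_repr x, TensorProduct.sum_tmul]
      refine Finset.sum_congr rfl fun j _ => ?_
      rw [hρ, Algebra.TensorProduct.tmul_mul_tmul, one_mul, mul_one, MulOpposite.op_smul,
        TensorProduct.smul_tmul]
      rfl
  refine ⟨Fin n × Fin (Module.finrank K A), inferInstance,
    fun ij => ((ρ ij.2).toAddMonoidHom.comp (Pi.evalAddMonoidHom _ ij.1)).comp s.toAddMonoidHom,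
    fun ij => (b ij.2 ⊗ₜ[K] (1 : Aᵐᵒᵖ) : A ⊗[K] Aᵐᵒᵖ) • c ij.1, fun ij d x => ?_, fun x => ?_⟩
  · change ρ ij.2 (s (rightMul (K := K) d x) ij.1) = ρ ij.2 (s x ij.1) * d
    rw [rightMul_def, map_smul, Pi.smul_apply, smul_eq_mul, hρ']
  · rw [Fintype.sum_prod_type]
    conv_rhs => rw [← hc x]
    refine Finset.sum_congr rfl fun i _ => ?_
    conv_rhs => rw [← hρs (s x i), Finset.sum_smul]
    refine Finset.sum_congr rfl fun j _ => ?_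
    rw [rightMul_def, smul_smul]
    rfl

/-! ### Tensoring bimodules with the simple module of a character. -/

variable (χ : A →ₐ[K] K)

/-- The sub-bimodule `M 𝔪` of a bimodule `M`, for the kernel `𝔪` of a character. -/
def charKernelSubmodule (M : Type w) [AddCommGroup M] [Module (A ⊗[K] Aᵐᵒᵖ) M] :
    Submodule (A ⊗[K] Aᵐᵒᵖ) M :=
  { AddSubgroup.closure {x : M | ∃ (b : A) (y : M), χ b = 0 ∧ x = rightMul (K := K) b y} with
    smul_mem' := by
      intro r x hx
      change r • x ∈ AddSubgroup.closure _
      change x ∈ AddSubgroup.closure _ at hx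
      induction r using TensorProduct.induction_on with
      | zero =>
        have h := zero_smul (A ⊗[K] Aᵐᵒᵖ) x
        exact (congrArg (· ∈ AddSubgroup.closure _) h).mpr (zero_mem _)
      | add r r' hr hr' => rw [add_smul]; exact add_mem hr hr'
      | tmul a c =>
        induction hx using AddSubgroup.closure_induction with
        | zero => rw [smul_zero]; exact zero_mem _
        | add x y _ _ hx hy => rw [smul_add]; exact add_mem hx hy
        | neg x _ hx => rw [smul_neg]; exact neg_mem hx
        | mem x hx =>
          obtain ⟨b, y, hb, rfl⟩ := hx
          refine AddSubgroup.subset_closure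
            ⟨b * c.unop, (a ⊗ₜ[K] (1 : Aᵐᵒᵖ) : A ⊗[K] Aᵐᵒᵖ) • y, by rw [map_mul, hb, zero_mul], ?_⟩
          rw [rightMul_def, rightMul_def, smul_smul, smul_smul,
            Algebra.TensorProduct.tmul_mul_tmul, Algebra.TensorProduct.tmul_mul_tmul,
            mul_one, one_mul, mul_one, MulOpposite.op_mul, MulOpposite.op_unop] }

theorem mem_charKernelSubmodule {M : Type w} [AddCommGroup M] [Module (A ⊗[K] Aᵐᵒᵖ) M] {x : M} :
    x ∈ charKernelSubmodule χ M ↔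
      x ∈ AddSubgroup.closure {x : M | ∃ (b : A) (y : M), χ b = 0 ∧ x = rightMul (K := K) b y} :=
  Iff.rfl

/-- The left module `M / M 𝔪` of a bimodule `M`. -/
def CharReduction (M : Type w) [AddCommGroup M] [Module (A ⊗[K] Aᵐᵒᵖ) M] : Type w :=
  M ⧸ charKernelSubmodule χ M

namespace CharReduction

variable {M : Type w} [AddCommGroup M] [Module (A ⊗[K] Aᵐᵒᵖ) M]

noncomputable instance : AddCommGroup (CharReduction χ M) :=
  inferInstanceAs (AddCommGroup (M ⧸ charKernelSubmodule χ M))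

noncomputable instance : Module A (CharReduction χ M) :=
  Module.compHom (M ⧸ charKernelSubmodule χ M)
    (Algebra.TensorProduct.includeLeft : A →ₐ[K] A ⊗[K] Aᵐᵒᵖ).toRingHom

/-- The projection of a bimodule to its reduction. -/
def mk : M →+ CharReduction χ M := (charKernelSubmodule χ M).mkQ.toAddMonoidHom

theorem mk_surjective : Function.Surjective (mk χ : M →+ CharReduction χ M) :=
  Submodule.mkQ_surjective _

theorem mk_eq_zero {x : M} : mk χ x = 0 ↔ x ∈ charKernelSubmodule χ M :=
  Submodule.Quotient.mk_eq_zero _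

theorem smul_mk (a : A) (x : M) :
    a • mk χ x = mk χ ((a ⊗ₜ[K] (1 : Aᵐᵒᵖ) : A ⊗[K] Aᵐᵒᵖ) • x) := rfl

/-- The linear map `a ⊗ b ↦ χ(b) a`. -/
noncomputable def envHom : A ⊗[K] Aᵐᵒᵖ →ₗ[K] A :=
  (TensorProduct.rid K A).toLinearMap.comp
    (TensorProduct.map LinearMap.id (χ.toLinearMap.comp (MulOpposite.opLinearEquiv K).symm.toLinearMap))

theorem envHom_tmul (a : A) (b : Aᵐᵒᵖ) : envHom χ (a ⊗ₜ b) = χ b.unop • a := rfl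

theorem envHom_mul_tmul_one (a : A) (r : A ⊗[K] Aᵐᵒᵖ) :
    envHom χ ((a ⊗ₜ[K] (1 : Aᵐᵒᵖ)) * r) = a * envHom χ r := by
  induction r using TensorProduct.induction_on with
  | zero => simp
  | add x y hx hy => rw [mul_add, map_add, hx, hy, map_add, mul_add]
  | tmul x y => rw [Algebra.TensorProduct.tmul_mul_tmul, one_mul, envHom_tmul, envHom_tmul,
      mul_smul_comm]

theorem envHom_mul_rightMul {b : A} (hb : χ b = 0) (r : A ⊗[K] Aᵐᵒᵖ) :
    envHom χ (((1 : A) ⊗ₜ[K] MulOpposite.op b) * r) = 0 := by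
  induction r using TensorProduct.induction_on with
  | zero => simp
  | add x y hx hy => rw [mul_add, map_add, hx, hy, add_zero]
  | tmul x y => rw [Algebra.TensorProduct.tmul_mul_tmul, envHom_tmul, MulOpposite.unop_mul,
      MulOpposite.unop_op, map_mul, hb, mul_zero, zero_smul]

/-- The element `b - χ(b)` is killed by `χ`, so right multiplication by `b` becomes the scalar
`χ(b)` in the reduction. -/
theorem mk_smul (r : A ⊗[K] Aᵐᵒᵖ) (x : M) : mk χ (r • x) = envHom χ r • mk χ x := by
  induction r using TensorProduct.induction_on with
  | zero =>
    have h := zero_smul (A ⊗[K] Aᵐᵒᵖ) x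
    rw [map_zero, zero_smul]
    exact (congrArg (mk χ) h).trans (map_zero _)
  | add r r' hr hr' => rw [add_smul, map_add, hr, hr', map_add, add_smul]
  | tmul a b =>
    rw [smul_mk, ← sub_eq_zero, ← map_sub, ← sub_smul, mk_eq_zero]
    refine AddSubgroup.subset_closure ⟨b.unop - algebraMap K A (χ b.unop),
      (a ⊗ₜ[K] (1 : Aᵐᵒᵖ) : A ⊗[K] Aᵐᵒᵖ) • x, by simp, ?_⟩
    rw [rightMul_def, smul_smul, Algebra.TensorProduct.tmul_mul_tmul, one_mul, mul_one,
      MulOpposite.op_sub, MulOpposite.op_unop, TensorProduct.tmul_sub, envHom_tmul,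
      TensorProduct.smul_tmul, Algebra.algebraMap_eq_smul_one, MulOpposite.op_smul,
      MulOpposite.op_one]

/-- The map of reductions induced by a map of bimodules. -/
noncomputable def map {M' : Type*} [AddCommGroup M'] [Module (A ⊗[K] Aᵐᵒᵖ) M']
    (f : M →ₗ[A ⊗[K] Aᵐᵒᵖ] M') : CharReduction χ M →ₗ[A] CharReduction χ M' :=
  let g : (M ⧸ charKernelSubmodule χ M) →ₗ[A ⊗[K] Aᵐᵒᵖ] (M' ⧸ charKernelSubmodule χ M') :=
    Submodule.mapQ _ _ f (by
      intro x hx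
      rw [mem_charKernelSubmodule] at hx
      change f x ∈ charKernelSubmodule χ M'
      induction hx using AddSubgroup.closure_induction with
      | zero => rw [map_zero]; exact zero_mem _
      | add x y _ _ hx hy => rw [map_add]; exact add_mem hx hy
      | neg x _ hx => rw [map_neg]; exact neg_mem hx
      | mem x hx =>
        obtain ⟨b, y, hb, rfl⟩ := hx
        rw [map_rightMul]
        exact AddSubgroup.subset_closure ⟨b, _, hb, rfl⟩)
  { toFun := g
    map_add' := g.map_add
    map_smul' := fun a x => g.map_smul (a ⊗ₜ[K] (1 : Aᵐᵒᵖ)) x }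

theorem map_mk {M' : Type*} [AddCommGroup M'] [Module (A ⊗[K] Aᵐᵒᵖ) M']
    (f : M →ₗ[A ⊗[K] Aᵐᵒᵖ] M') (x : M) : map χ f (mk χ x) = mk χ (f x) := rfl

/-- The reduction of the enveloping algebra is `A`, by means of `envHom`; applying it to the
coordinates of a dual basis of `P` gives a dual basis of the reduction. -/
theorem isFiniteFreeRetract (P : Type*) [AddCommGroup P]
    [Module (A ⊗[K] Aᵐᵒᵖ) P] [Module.Projective (A ⊗[K] Aᵐᵒᵖ) P]
    [Module.Finite (A ⊗[K] Aᵐᵒᵖ) P] : IsFiniteFreeRetract A (CharReduction χ P) := by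
  obtain ⟨n, s, c, hc⟩ := exists_dual_basis_of_projective (R := A ⊗[K] Aᵐᵒᵖ) P
  have hker : ∀ x ∈ charKernelSubmodule χ P, ∀ i, envHom χ (s x i) = 0 := by
    intro x hx i
    rw [mem_charKernelSubmodule] at hx
    induction hx using AddSubgroup.closure_induction with
    | zero => simp
    | add x y _ _ hx hy => rw [map_add, Pi.add_apply, map_add, hx, hy, add_zero]
    | neg x _ hx => rw [map_neg, Pi.neg_apply, map_neg, hx, neg_zero]
    | mem x hx =>
      obtain ⟨b, y, hb, rfl⟩ := hx
      rw [rightMul_def, map_smul, Pi.smul_apply, smul_eq_mul, envHom_mul_rightMul χ hb]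
  have key : ∀ x y, mk χ x = mk χ y → ∀ i, envHom χ (s x i) = envHom χ (s y i) := by
    intro x y hxy i
    rw [← sub_eq_zero, ← map_sub, ← Pi.sub_apply, ← map_sub]
    exact hker _ ((mk_eq_zero χ).1 (by rw [map_sub, hxy, sub_self])) i
  choose σ hσ using mk_surjective χ (M := P)
  refine ⟨Fin n, inferInstance,
    { toFun := fun x i => envHom χ (s (σ x) i)
      map_add' := fun x y => ?_
      map_smul' := fun a x => ?_ },
    Fintype.linearCombination A (fun i => mk χ (c i)), fun x => ?_⟩
  · ext i
    rw [key (σ (x + y)) (σ x + σ y) (by rw [map_add, hσ, hσ, hσ]), map_add, Pi.add_apply, map_add]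
    rfl
  · ext i
    rw [key (σ (a • x)) ((a ⊗ₜ[K] (1 : Aᵐᵒᵖ) : A ⊗[K] Aᵐᵒᵖ) • σ x)
      (by rw [← smul_mk, hσ, hσ]), map_smul, Pi.smul_apply, smul_eq_mul, envHom_mul_tmul_one]
    rfl
  · rw [Fintype.linearCombination_apply]
    conv_rhs => rw [← hσ x, ← hc (σ x), map_sum]
    exact Finset.sum_congr rfl fun i _ => (mk_smul χ _ _).symm

theorem map_surjective {M' : Type*} [AddCommGroup M'] [Module (A ⊗[K] Aᵐᵒᵖ) M']
    {f : M →ₗ[A ⊗[K] Aᵐᵒᵖ] M'} (hf : Function.Surjective f) : Function.Surjective (map χ f) := by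
  intro y
  obtain ⟨y, rfl⟩ := mk_surjective χ y
  obtain ⟨x, rfl⟩ := hf y
  exact ⟨mk χ x, map_mk χ f x⟩

/-- This is the vanishing of a Tor group: the sequence splits on the right, and a right-linear
retraction carries `B 𝔪` into `L 𝔪`. -/
theorem map_injective {L B C : Type*} [AddCommGroup L] [AddCommGroup B]
    [AddCommGroup C] [Module (A ⊗[K] Aᵐᵒᵖ) L] [Module (A ⊗[K] Aᵐᵒᵖ) B] [Module (A ⊗[K] Aᵐᵒᵖ) C]
    (hC : HasRightDualBasis K A C) {i : L →ₗ[A ⊗[K] Aᵐᵒᵖ] B} {p : B →ₗ[A ⊗[K] Aᵐᵒᵖ] C}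
    (hi : Function.Injective i) (hp : Function.Surjective p) (e : Function.Exact i p) :
    Function.Injective (map χ i) := by
  obtain ⟨r, hr, hr'⟩ := hC.exists_retraction hi hp e
  refine (injective_iff_map_eq_zero _).2 fun x hx => ?_
  obtain ⟨x, rfl⟩ := mk_surjective χ x
  rw [map_mk, mk_eq_zero, mem_charKernelSubmodule] at hx
  rw [← hr x, mk_eq_zero]
  generalize i x = y at hx
  induction hx using AddSubgroup.closure_induction with
  | zero => rw [map_zero]; exact zero_mem _
  | add x y _ _ hx hy => rw [map_add]; exact add_mem hx hy
  | neg x _ hx => rw [map_neg]; exact neg_mem hx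
  | mem x hx =>
    obtain ⟨b, y, hb, rfl⟩ := hx
    rw [hr']
    exact AddSubgroup.subset_closure ⟨b, _, hb, rfl⟩

theorem map_exact {L B C : Type*} [AddCommGroup L] [AddCommGroup B]
    [AddCommGroup C] [Module (A ⊗[K] Aᵐᵒᵖ) L] [Module (A ⊗[K] Aᵐᵒᵖ) B] [Module (A ⊗[K] Aᵐᵒᵖ) C]
    {i : L →ₗ[A ⊗[K] Aᵐᵒᵖ] B} {p : B →ₗ[A ⊗[K] Aᵐᵒᵖ] C}
    (hp : Function.Surjective p) (e : Function.Exact i p) :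
    Function.Exact (map χ i) (map χ p) := by
  intro x
  constructor
  · intro hx
    obtain ⟨x, rfl⟩ := mk_surjective χ x
    rw [map_mk, mk_eq_zero, mem_charKernelSubmodule] at hx
    have key : ∀ y ∈ charKernelSubmodule χ C, ∃ z ∈ charKernelSubmodule χ B, p z = y := by
      intro y hy
      rw [mem_charKernelSubmodule] at hy
      induction hy using AddSubgroup.closure_induction with
      | zero => exact ⟨0, zero_mem _, map_zero _⟩
      | add x y _ _ hx hy =>
        obtain ⟨x', hx', rfl⟩ := hx
        obtain ⟨y', hy', rfl⟩ := hy
        exact ⟨x' + y', add_mem hx' hy', map_add _ _ _⟩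
      | neg x _ hx =>
        obtain ⟨x', hx', rfl⟩ := hx
        exact ⟨-x', neg_mem hx', map_neg _ _⟩
      | mem x hx =>
        obtain ⟨b, y, hb, rfl⟩ := hx
        obtain ⟨y, rfl⟩ := hp y
        exact ⟨rightMul (K := K) b y, AddSubgroup.subset_closure ⟨b, _, hb, rfl⟩, map_rightMul _ _ _⟩
    obtain ⟨z, hz, hzx⟩ := key _ hx
    obtain ⟨l, hl⟩ := (e (x - z)).1 (by rw [map_sub, hzx, sub_self])
    refine ⟨mk χ l, ?_⟩
    rw [map_mk, hl, map_sub, (mk_eq_zero χ).2 hz, sub_zero]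
  · rintro ⟨y, rfl⟩
    obtain ⟨y, rfl⟩ := mk_surjective χ y
    rw [map_mk, map_mk, e.apply_apply_eq_zero, map_zero]

end CharReduction

end Reduction

/-! ### Symmetric algebras are self-injective -/

section Symmetric

variable {K : Type u} {A : Type v} [Field K] [Ring A] [Algebra K A]

theorem LinearMap.BilinForm.Nondegenerate.eq_of_forall {B : LinearMap.BilinForm K A}
    (hB : B.Nondegenerate) {x y : A} (h : ∀ a, B x a = B y a) : x = y :=
  sub_eq_zero.1 (hB.1 _ fun a => by rw [map_sub, LinearMap.sub_apply, h, sub_self])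

theorem IsSymmAlgebra.injective [FiniteDimensional K A] (h : IsSymmAlgebra K A) :
    Module.Injective A A := by
  obtain ⟨B, hB, hs, ha⟩ := h
  refine Module.Baer.injective fun I g => ?_
  -- Baer's criterion: the functional `B 1 ∘ g` extends to all of `A` by linear algebra and is
  -- represented by some `q` under `B`; right multiplication by `q` extends `g`.
  let g' : I.restrictScalars K →ₗ[K] K :=
    { toFun := fun x => B 1 (g x)
      map_add' := fun x y => by
        rw [← map_add]
        exact congrArg (B 1) (map_add g x y)
      map_smul' := fun c x => by
        rw [RingHom.id_apply, ← map_smul]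
        refine congrArg (B 1) (Eq.trans (congrArg g (Subtype.ext ?_))
          ((map_smul g (algebraMap K A c) x).trans (algebraMap_smul A c (g x))))
        exact (algebraMap_smul A c (x : A)).symm }
  obtain ⟨l, hl⟩ := LinearMap.exists_extend g'
  have hq : ∀ x, B ((B.toDual hB).symm l) x = l x :=
    LinearMap.BilinForm.apply_toDual_symm_apply l
  refine ⟨LinearMap.toSpanSingleton A A ((B.toDual hB).symm l), fun x hx => ?_⟩
  rw [LinearMap.toSpanSingleton_apply, smul_eq_mul]
  refine hB.eq_of_forall fun y => ?_
  have h1 : l (y * x) = B 1 (g (y • ⟨x, hx⟩)) :=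
    LinearMap.congr_fun hl (⟨y * x, I.mul_mem_left y hx⟩ : I.restrictScalars K)
  rw [ha, hs, ha, hq, h1, map_smul, smul_eq_mul, ← ha, one_mul, hs]

/-- A character of a symmetric algebra is represented by an element `z`, which spans the elements
of `A e` annihilated by the generators of the radical of `e A`. -/
theorem IsSymmAlgebra.exists_socle [FiniteDimensional K A] (h : IsSymmAlgebra K A)
    (χ : A →ₐ[K] K) {e : A} (hχe : χ e = 1) (he : e * e = e) {κ : Type*} [Fintype κ] (y : κ → A)
    (hygen : ∀ p, e * p = p → χ p = 0 → ∃ r : κ → A, p = ∑ k, y k * r k)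
    (hyχ : ∀ k, χ (y k) = 0) :
    ∃ z : A, z ≠ 0 ∧ z * e = z ∧ (∀ a, a * z = χ a • z) ∧ (∀ k, z * y k = 0) ∧
      ∀ p, p * e = p → (∀ k, p * y k = 0) → ∃ c : K, p = c • z := by
  obtain ⟨B, hB, hs, ha⟩ := h
  have hz : ∀ x, B ((B.toDual hB).symm χ.toLinearMap) x = χ x :=
    LinearMap.BilinForm.apply_toDual_symm_apply χ.toLinearMap
  -- The element representing `χ` is a two-sided eigenvector: `a z = z a = χ(a) z`.
  generalize (B.toDual hB).symm χ.toLinearMap = z at hz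
  have hz' : ∀ a, z * a = χ a • z := fun a => hB.eq_of_forall fun x => by
    rw [ha, hz, map_smul, LinearMap.smul_apply, hz, map_mul, smul_eq_mul]
  refine ⟨z, ?_, ?_, fun a => hB.eq_of_forall fun x => ?_, fun k => ?_, fun p hp hpy => ?_⟩
  · rintro rfl
    have := hz e
    rw [hχe, map_zero, LinearMap.zero_apply] at this
    exact zero_ne_one this
  · rw [hz', hχe, one_smul]
  · rw [ha, hs, ha, hz, map_smul, LinearMap.smul_apply, hz, map_mul, smul_eq_mul, mul_comm]
  · rw [hz', hyχ, zero_smul]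
  · refine ⟨B p e, hB.eq_of_forall fun x => ?_⟩
    -- This element lies in the right ideal generated by the `y k`, which `p` annihilates. Hence the
    -- functionals `B p` and `χ` are proportional, with factor `B p e`.
    obtain ⟨r, hr⟩ := hygen (e * x - χ x • e) (by rw [mul_sub, mul_smul_comm, he, ← mul_assoc, he])
      (by rw [map_sub, map_mul, map_smul, hχe, one_mul, smul_eq_mul, mul_one, sub_self])
    have h1 : B p (e * x - χ x • e) = 0 := by
      rw [hr, map_sum]
      refine Finset.sum_eq_zero fun k _ => ?_
      rw [← ha, hpy, map_zero, LinearMap.zero_apply]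
    rw [map_sub, map_smul, sub_eq_zero, ← ha, hp] at h1
    rw [h1, map_smul, LinearMap.smul_apply, hz, smul_eq_mul, smul_eq_mul, mul_comm]

/-- An element of a symmetric algebra which kills the radical on one side is zero, if its source
and target are different. -/
theorem IsSymmAlgebra.eq_zero_of_forall {ι : Type*} [Fintype ι] (h : IsSymmAlgebra K A)
    (e : ι → A) (J : Set A) (hJ : ∀ a : A, ∃ c : ι → K, a - ∑ i, c i • e i ∈ J) (x : A)
    (hx : ∀ i, e i * x * e i = 0) (he : ∀ i, e i * e i = e i)
    (hxJ : (∀ a ∈ J, x * a = 0) ∨ ∀ a ∈ J, a * x = 0) : x = 0 := by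
  obtain ⟨B, hB, hs, ha⟩ := h
  have h1 : ∀ a ∈ J, B x a = 0 := by
    intro a haJ
    rcases hxJ with hxJ | hxJ
    · rw [← mul_one a, ← ha, hxJ a haJ, map_zero, LinearMap.zero_apply]
    · rw [hs, ← mul_one x, ← ha, hxJ a haJ, map_zero, LinearMap.zero_apply]
  -- By symmetry `B x (e i)` equals the pairing of `e i * x * e i` with `1`.
  have h2 : ∀ i, B x (e i) = 0 := by
    intro i
    rw [← he i, ← ha, hs, ← mul_one (x * e i), ← ha, ← mul_assoc, hx, map_zero,
      LinearMap.zero_apply]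
  refine hB.1 x fun a => ?_
  obtain ⟨c, hc⟩ := hJ a
  have h3 := h1 _ hc
  rw [map_sub, sub_eq_zero, map_sum] at h3
  rw [h3]
  exact Finset.sum_eq_zero fun i _ => by rw [map_smul, h2, smul_zero]

end Symmetric

/-! ### Minimal presentations of simple modules over periodic algebras -/

section Periodic

/-- Minimality of the cover can be forgotten, because stable retracts do not see projective
summands. -/
theorem IsSyzygy.exists_exact {R : Type u} [Ring R] {M N : ModuleCat.{v} R} (h : IsSyzygy M N) :
    ∃ (P : ModuleCat.{v} R) (i : N →ₗ[R] P) (p : P →ₗ[R] M), Module.Projective R P ∧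
      Module.Finite R P ∧ Function.Injective i ∧ Function.Surjective p ∧ Function.Exact i p := by
  obtain ⟨P, p, hP, hP', hp, -, ⟨e⟩⟩ := h
  refine ⟨P, (LinearMap.ker p).subtype.comp e.toLinearMap, p, hP, hP',
    (LinearMap.ker p).injective_subtype.comp e.injective, hp, fun x => ?_⟩
  constructor
  · intro hx
    exact ⟨e.symm ⟨x, hx⟩, by simp⟩
  · rintro ⟨y, rfl⟩
    exact (e y).2

variable {K : Type u} {A : Type v} [Field K] [Ring A] [Algebra K A]

/-- The direct sum of the left ideals `A εᵢ`, for a finite family of elements `εᵢ`. -/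
def idemSubmodule {ι : Type w} (ε : ι → A) : Submodule A (ι → A) where
  carrier := {q | ∀ i, q i * ε i = q i}
  add_mem' hq hr i := by rw [Pi.add_apply, add_mul, hq i, hr i]
  zero_mem' i := zero_mul _
  smul_mem' a q hq i := by rw [Pi.smul_apply, smul_eq_mul, mul_assoc, hq i]

theorem isFiniteFreeRetract_idemSubmodule {ι : Type} [Finite ι] (ε : ι → A)
    (hε : ∀ i, ε i * ε i = ε i) : IsFiniteFreeRetract A (idemSubmodule ε) := by
  refine ⟨ι, inferInstance, (idemSubmodule ε).subtype,
    { toFun := fun q => ⟨fun i => q i * ε i, fun i => by rw [mul_assoc, hε]⟩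
      map_add' := fun q r => Subtype.ext (funext fun i => add_mul _ _ _)
      map_smul' := fun a q => Subtype.ext (funext fun i => mul_assoc _ _ _) }, fun q => ?_⟩
  exact Subtype.ext (funext q.2)

/-- The underlying additive group of the regular bimodule. -/
noncomputable def regularBimoduleEquiv (K : Type u) (A : Type v) [Field K] [Ring A] [Algebra K A] :
    A ≃+ regularBimodule K A :=
  AddEquiv.refl A

theorem regularBimodule_smul (a b x : A) :
    (a ⊗ₜ[K] MulOpposite.op b : A ⊗[K] Aᵐᵒᵖ) • regularBimoduleEquiv K A x =
      regularBimoduleEquiv K A (a * x * b) := by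
  let _ : Module (A ⊗[K] Aᵐᵒᵖ) A := TensorProduct.Algebra.module
  refine (TensorProduct.Algebra.smul_def a (MulOpposite.op b) x).trans ?_
  rw [MulOpposite.smul_eq_mul_unop, smul_eq_mul, mul_assoc]
  rfl

theorem rightMul_regularBimodule (b x : A) :
    rightMul (K := K) b (regularBimoduleEquiv K A x) = regularBimoduleEquiv K A (x * b) := by
  rw [rightMul_def, regularBimodule_smul, one_mul]

theorem hasRightDualBasis_regularBimodule : HasRightDualBasis K A (regularBimodule K A) := by
  refine ⟨Unit, inferInstance, fun _ => (regularBimoduleEquiv K A).symm.toAddMonoidHom,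
    fun _ => regularBimoduleEquiv K A 1, fun _ b x => ?_, fun x => ?_⟩
  · obtain ⟨x, rfl⟩ := (regularBimoduleEquiv K A).surjective x
    rw [rightMul_regularBimodule]
    simp
  · obtain ⟨x, rfl⟩ := (regularBimoduleEquiv K A).surjective x
    rw [Fintype.sum_unique, rightMul_regularBimodule]
    simp

/-- The reduction of the regular bimodule is the simple module of the character. -/
theorem exists_regularBimodule_reduction (χ : A →ₐ[K] K) :
    ∃ σ : A →ₗ[A] CharReduction χ (regularBimodule K A), Function.Surjective σ ∧
      ∀ a, σ a = 0 ↔ χ a = 0 := by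
  refine ⟨{ toFun := fun a => CharReduction.mk χ (regularBimoduleEquiv K A a)
            map_add' := fun a b => by rw [map_add, map_add]
            map_smul' := fun a x => ?_ }, fun s => ?_, fun a => ?_⟩
  · rw [RingHom.id_apply, CharReduction.smul_mk, ← MulOpposite.op_one, regularBimodule_smul,
      mul_one, smul_eq_mul]
  · obtain ⟨t, rfl⟩ := CharReduction.mk_surjective χ s
    obtain ⟨x, rfl⟩ := (regularBimoduleEquiv K A).surjective t
    exact ⟨x, rfl⟩
  · change CharReduction.mk χ (regularBimoduleEquiv K A a) = 0 ↔ _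
    rw [CharReduction.mk_eq_zero, mem_charKernelSubmodule]
    constructor
    · intro h
      let χ' : (regularBimodule K A) →+ K :=
        (χ : A →+ K).comp (regularBimoduleEquiv K A).symm.toAddMonoidHom
      have hχ' : ∀ x, χ' (regularBimoduleEquiv K A x) = χ x := fun x => by simp [χ']
      have h' : regularBimoduleEquiv K A a ∈ χ'.ker := by
        refine (AddSubgroup.closure_le χ'.ker).2 ?_ h
        rintro _ ⟨b, y, hb, rfl⟩
        obtain ⟨y, rfl⟩ := (regularBimoduleEquiv K A).surjective y
        rw [rightMul_regularBimodule]
        exact (hχ' _).trans (by rw [map_mul, hb, mul_zero])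
      exact (hχ' a).symm.trans h'
    · intro h
      refine AddSubgroup.subset_closure ⟨a, regularBimoduleEquiv K A 1, h, ?_⟩
      rw [rightMul_regularBimodule, one_mul]

/-- The simple module of a character of a periodic algebra of period four has a second syzygy,
which is also a second cosyzygy. -/
theorem exists_second_syzygy [FiniteDimensional K A] (hA : Module.Injective A A)
    (hper : IsPeriodicAlgebra K A 4) (χ : A →ₐ[K] K) :
    ∃ L : ModuleCat.{v} A,
      (∀ {E₀ E₁ : Type v} [AddCommGroup E₀] [AddCommGroup E₁] [Module A E₀] [Module A E₁]
        (p₀ : E₀ →ₗ[A] CharReduction χ (regularBimodule K A)) (p₁ : E₁ →ₗ[A] LinearMap.ker p₀),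
        Function.Surjective p₀ → IsFiniteFreeRetract A E₀ → Function.Surjective p₁ →
        IsFiniteFreeRetract A E₁ → IsStableRetract A (LinearMap.ker p₁) L) ∧
      (∀ {E₀ E₁ : Type v} [AddCommGroup E₀] [AddCommGroup E₁] [Module A E₀] [Module A E₁]
        (i₀ : CharReduction χ (regularBimodule K A) →ₗ[A] E₀)
        (i₁ : (E₀ ⧸ LinearMap.range i₀) →ₗ[A] E₁),
        Function.Injective i₀ → IsFiniteFreeRetract A E₀ → Function.Injective i₁ →
        IsFiniteFreeRetract A E₁ → IsStableRetract A L (E₁ ⧸ LinearMap.range i₁)) := by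
  obtain ⟨L₁, h₁, L₂, h₂, L₃, h₃, L₄, h₄, ⟨ε⟩⟩ := hper.1.2
  obtain ⟨P₀, i₀, p₀, hP₀, hP₀', hi₀, hp₀, ex₀⟩ := h₁.exists_exact
  obtain ⟨P₁, i₁, p₁, hP₁, hP₁', hi₁, hp₁, ex₁⟩ := h₂.exists_exact
  obtain ⟨P₂, i₂, p₂, hP₂, hP₂', hi₂, hp₂, ex₂⟩ := h₃.exists_exact
  obtain ⟨P₃, i₃, p₃, hP₃, hP₃', hi₃, hp₃, ex₃⟩ := h₄.exists_exact
  have d₀ : HasRightDualBasis K A (regularBimodule K A) := hasRightDualBasis_regularBimodule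
  have d₁ := (HasRightDualBasis.of_projective P₀).kernel d₀ hi₀ hp₀ ex₀
  have d₂ := (HasRightDualBasis.of_projective P₁).kernel d₁ hi₁ hp₁ ex₁
  have d₃ := (HasRightDualBasis.of_projective P₂).kernel d₂ hi₂ hp₂ ex₂
  -- The isomorphism `ε` of the regular bimodule with its fourth syzygy closes the resolution: the
  -- bimodule embeds in `P₃` with cokernel `L₃`, so `L₂` is a second syzygy from one end and a
  -- second cosyzygy from the other.
  have hi₃' : Function.Injective (i₃.comp ε.toLinearMap) := hi₃.comp ε.injective
  have ex₃' : Function.Exact (i₃.comp ε.toLinearMap) p₃ := fun t =>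
    (ex₃ t).trans ⟨fun ⟨s, hs⟩ => ⟨ε.symm s, by simp [hs]⟩, fun ⟨s, hs⟩ => ⟨ε s, hs⟩⟩
  refine ⟨ModuleCat.of A (CharReduction χ L₂), ?_, ?_⟩
  · intro E₀ E₁ _ _ _ _ q₀ q₁ hq₀ hE₀ hq₁ hE₁
    have s₁ : IsStableRetract A (LinearMap.ker q₀) (CharReduction χ L₁) :=
      (IsStableRetract.refl _).syzygy (LinearMap.ker q₀).injective_subtype hq₀
        (LinearMap.exact_subtype_ker_map q₀) hE₀
        (CharReduction.map_injective χ d₀ hi₀ hp₀ ex₀)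
        (CharReduction.map_surjective χ hp₀) (CharReduction.map_exact χ hp₀ ex₀)
        (CharReduction.isFiniteFreeRetract χ P₀)
    exact s₁.syzygy (LinearMap.ker q₁).injective_subtype hq₁
        (LinearMap.exact_subtype_ker_map q₁) hE₁ (CharReduction.map_injective χ d₁ hi₁ hp₁ ex₁)
        (CharReduction.map_surjective χ hp₁) (CharReduction.map_exact χ hp₁ ex₁)
        (CharReduction.isFiniteFreeRetract χ P₁)
  · intro E₀ E₁ _ _ _ _ j₀ j₁ hj₀ hE₀ hj₁ hE₁
    have s₃ : IsStableRetract A (CharReduction χ L₃) (E₀ ⧸ LinearMap.range j₀) :=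
      (IsStableRetract.refl (CharReduction χ (regularBimodule K A))).cosyzygy hA
        (CharReduction.map_injective χ d₃ hi₃' hp₃ ex₃')
        (CharReduction.map_surjective χ hp₃) (CharReduction.map_exact χ hp₃ ex₃')
        (CharReduction.isFiniteFreeRetract χ P₃) hj₀ (Submodule.mkQ_surjective _)
        (LinearMap.exact_map_mkQ_range j₀) hE₀
    exact s₃.cosyzygy hA (CharReduction.map_injective χ d₂ hi₂ hp₂ ex₂)
      (CharReduction.map_surjective χ hp₂) (CharReduction.map_exact χ hp₂ ex₂)
      (CharReduction.isFiniteFreeRetract χ P₂) hj₁ (Submodule.mkQ_surjective _)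
      (LinearMap.exact_map_mkQ_range j₁) hE₁

/-- The map `(qᵢ) ↦ ∑ qᵢ xᵢ` from `⨁ A εᵢ` to `A e`. -/
def idemSum {ι : Type w} [Fintype ι] (ε x : ι → A) (e : A) (hxe : ∀ i, x i * e = x i) :
    idemSubmodule ε →ₗ[A] idemSubmodule (fun _ : Unit => e) where
  toFun q := ⟨fun _ => ∑ i, q.1 i * x i, fun _ => by
    rw [Finset.sum_mul]
    exact Finset.sum_congr rfl fun i _ => by rw [mul_assoc, hxe]⟩
  map_add' q r := Subtype.ext (funext fun _ => by simp [add_mul, Finset.sum_add_distrib])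
  map_smul' a q := Subtype.ext (funext fun _ => by simp [mul_assoc, Finset.mul_sum])

/-- The map `p ↦ (p yₖ)` from `A e` to `⨁ A εₖ`. -/
def idemDiag {κ : Type w} (ε y : κ → A) (e : A) (hy : ∀ k, y k * ε k = y k) :
    idemSubmodule (fun _ : Unit => e) →ₗ[A] idemSubmodule ε where
  toFun p := ⟨fun k => p.1 () * y k, fun k => by rw [mul_assoc, hy]⟩
  map_add' _ _ := Subtype.ext (funext fun _ => add_mul _ _ _)
  map_smul' _ _ := Subtype.ext (funext fun _ => mul_assoc _ _ _)

theorem idemSubmodule_single_mem {ι : Type w} [DecidableEq ι] (ε : ι → A)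
    (hε : ∀ i, ε i * ε i = ε i) (i : ι) : Pi.single i (ε i) ∈ idemSubmodule ε := fun i' => by
  rcases eq_or_ne i' i with rfl | h
  · rw [Pi.single_eq_same, hε]
  · rw [Pi.single_eq_of_ne h, zero_mul]

theorem idemSubmodule_eq_sum {ι : Type w} [DecidableEq ι] [Fintype ι] (ε : ι → A)
    (hε : ∀ i, ε i * ε i = ε i) (q : idemSubmodule ε) :
    q = ∑ i, q.1 i • (⟨_, idemSubmodule_single_mem ε hε i⟩ : idemSubmodule ε) := by
  refine Subtype.ext (funext fun i => ?_)
  rw [AddSubmonoidClass.coe_finsetSum, Finset.sum_apply, Finset.sum_eq_single i]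
  · simpa using (q.2 i).symm
  · intro i' _ hi'
    simp [Pi.single_eq_of_ne' hi']
  · simp

/-! ### Presentation and copresentation of a simple module. -/

variable (χ : A →ₐ[K] K) {e : A}

/-- The beginning of a projective resolution of the simple module of a character. -/
theorem exists_presentation (he : e * e = e) (hχe : χ e = 1) {ι : Type} [Fintype ι]
    (x ex : ι → A) (hex : ∀ i, ex i * ex i = ex i) (hx : ∀ i, ex i * x i = x i)
    (hxe : ∀ i, x i * e = x i) (hxχ : ∀ i, χ (x i) = 0)
    (hxgen : ∀ p, p * e = p → χ p = 0 → ∃ q : ι → A, p = ∑ i, q i * x i) :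
    ∃ p₀ : idemSubmodule (fun _ : Unit => e) →ₗ[A] CharReduction χ (regularBimodule K A),
      Function.Surjective p₀ ∧
      ∃ p₁ : idemSubmodule ex →ₗ[A] LinearMap.ker p₀, Function.Surjective p₁ ∧
        LinearMap.ker p₁ = LinearMap.ker (idemSum ex x e hxe) := by
  obtain ⟨σ, hσ, hσ0⟩ := exists_regularBimodule_reduction (K := K) χ
  refine ⟨σ.comp ((LinearMap.proj ()).comp (Submodule.subtype _)), fun s => ?_,
    (idemSum ex x e hxe).codRestrict _ fun q => ?_, ?_, LinearMap.ker_codRestrict _ _ _⟩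
  · obtain ⟨a, rfl⟩ := hσ s
    refine ⟨⟨fun _ => a * e, fun _ => by rw [mul_assoc, he]⟩, ?_⟩
    change σ (a * e) = σ a
    rw [← sub_eq_zero, ← map_sub, hσ0, map_sub, map_mul, hχe, mul_one, sub_self]
  · change σ (∑ i, q.1 i * x i) = 0
    rw [hσ0, map_sum]
    exact Finset.sum_eq_zero fun i _ => by rw [map_mul, hxχ, mul_zero]
  · rintro ⟨⟨p, hp⟩, hp'⟩
    obtain ⟨q, hq⟩ := hxgen (p ()) (hp ()) ((hσ0 _).1 hp')
    refine ⟨⟨fun i => q i * ex i, fun i => by rw [mul_assoc, hex]⟩, ?_⟩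
    refine Subtype.ext (Subtype.ext (funext fun _ => ?_))
    change ∑ i, q i * ex i * x i = p ()
    rw [hq]
    exact Finset.sum_congr rfl fun i _ => by rw [mul_assoc, hx]

/-- The beginning of an injective resolution of the simple module of a character of a symmetric
algebra. -/
theorem exists_copresentation [FiniteDimensional K A] (hsymm : IsSymmAlgebra K A)
    (he : e * e = e) (hχe : χ e = 1) {κ : Type} [Fintype κ]
    (y ey : κ → A) (hy : ∀ k, y k * ey k = y k) (hyχ : ∀ k, χ (y k) = 0)
    (hygen : ∀ p, e * p = p → χ p = 0 → ∃ r : κ → A, p = ∑ k, y k * r k) :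
    ∃ j₀ : CharReduction χ (regularBimodule K A) →ₗ[A] idemSubmodule (fun _ : Unit => e),
      Function.Injective j₀ ∧
      ∃ j₁ : (idemSubmodule (fun _ : Unit => e) ⧸ LinearMap.range j₀) →ₗ[A] idemSubmodule ey,
        Function.Injective j₁ ∧ LinearMap.range j₁ = LinearMap.range (idemDiag ey y e hy) := by
  obtain ⟨z, hz0, hze, hzl, hzy, hzs⟩ := hsymm.exists_socle χ hχe he y hygen hyχ
  obtain ⟨σ, hσ, hσ0⟩ := exists_regularBimodule_reduction (K := K) χ
  -- The socle embedding is `a ↦ a z`, built on `A` and factored through the simple quotient. Its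
  -- image is exactly the set of `p` in `A e` with all `p * y k = 0`, so right multiplication by the
  -- `y k` embeds the cokernel.
  obtain ⟨j₀, hj₀⟩ := exists_factor_through_surjective σ hσ
    (idemDiag (fun _ : Unit => e) (fun _ => z) 1 (fun _ => hze) ∘ₗ
      ({ toFun := fun a => ⟨fun _ => a, fun _ => mul_one a⟩
         map_add' := fun _ _ => rfl
         map_smul' := fun _ _ => rfl } : A →ₗ[A] idemSubmodule (fun _ : Unit => (1 : A))))
    (fun a ha => Subtype.ext (funext fun _ => by
      change a * z = 0
      rw [hzl, (hσ0 a).1 ha, zero_smul]))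
  have hj₀' : ∀ a, (j₀ (σ a)).1 () = a * z := fun a => by rw [hj₀]; rfl
  refine ⟨j₀, (injective_iff_map_eq_zero _).2 fun s hs => ?_,
    (LinearMap.range j₀).liftQ (idemDiag ey y e hy) ?_,
    (injective_iff_map_eq_zero _).2 fun s hs => ?_, Submodule.range_liftQ _ _ _⟩
  · obtain ⟨a, rfl⟩ := hσ s
    have := hj₀' a
    rw [hs, hzl] at this
    exact (hσ0 a).2 ((smul_eq_zero.1 this.symm).resolve_right hz0)
  · rintro _ ⟨s, rfl⟩
    obtain ⟨a, rfl⟩ := hσ s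
    refine Subtype.ext (funext fun k => ?_)
    change (j₀ (σ a)).1 () * y k = 0
    rw [hj₀', mul_assoc, hzy, mul_zero]
  · obtain ⟨p, rfl⟩ := Submodule.mkQ_surjective _ s
    rw [Submodule.mkQ_apply, Submodule.liftQ_apply] at hs
    obtain ⟨c, hc⟩ := hzs (p.1 ()) (p.2 ()) fun k => congrFun (congrArg Subtype.val hs) k
    rw [Submodule.mkQ_apply, Submodule.Quotient.mk_eq_zero]
    refine ⟨σ (algebraMap K A c), Subtype.ext (funext fun _ => ?_)⟩
    rw [hj₀', ← Algebra.smul_def]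
    exact hc.symm

/-- For a symmetric periodic algebra of period four, the second syzygy of the simple module of a
character is generated by elements indexed by the generators of the radical on the other side. -/
theorem exists_syzygy_matrix_of_type [FiniteDimensional K A] (hsymm : IsSymmAlgebra K A)
    (hper : IsPeriodicAlgebra K A 4) (he : e * e = e) (hχe : χ e = 1)
    {ι κ : Type} [Fintype ι] [Fintype κ]
    (x ex : ι → A) (hex : ∀ i, ex i * ex i = ex i) (hx : ∀ i, ex i * x i = x i)
    (hxe : ∀ i, x i * e = x i) (hxχ : ∀ i, χ (x i) = 0)
    (hxgen : ∀ p, p * e = p → χ p = 0 → ∃ q : ι → A, p = ∑ i, q i * x i)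
    (y ey : κ → A) (hey : ∀ k, ey k * ey k = ey k) (hy : ∀ k, y k * ey k = y k)
    (hye : ∀ k, e * y k = y k) (hyχ : ∀ k, χ (y k) = 0)
    (hygen : ∀ p, e * p = p → χ p = 0 → ∃ r : κ → A, p = ∑ k, y k * r k)
    (J : Ideal A) [J.IsTwoSided] {n : ℕ} (hJ : J ^ n = ⊥)
    (hrad : ∀ q : ι → A, (∀ i, q i * ex i = q i) → ∑ i, q i * x i = 0 → ∀ i, q i ∈ J) :
    ∃ φ : κ → ι → A, (∀ k i, ey k * φ k i = φ k i) ∧ (∀ k i, φ k i * ex i = φ k i) ∧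
      (∀ k, ∑ i, φ k i * x i = 0) ∧ (∀ i, ∑ k, y k * φ k i = 0) ∧
      ∀ q : ι → A, (∀ i, q i * ex i = q i) → ∑ i, q i * x i = 0 →
        ∃ c : κ → A, ∀ i, q i = ∑ k, c k * φ k i := by
  classical
  have hA := hsymm.injective
  obtain ⟨L, hL, hL'⟩ := exists_second_syzygy hA hper χ
  obtain ⟨p₀, hp₀, p₁, hp₁, hker⟩ := exists_presentation χ he hχe x ex hex hx hxe hxχ hxgen
  obtain ⟨j₀, hj₀, j₁, hj₁, hrange⟩ := exists_copresentation χ hsymm he hχe y ey hy hyχ hygen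
  have hE₀ := isFiniteFreeRetract_idemSubmodule (fun _ : Unit => e) fun _ => he
  have hE₁ := isFiniteFreeRetract_idemSubmodule ex hex
  have hF₁ := isFiniteFreeRetract_idemSubmodule ey hey
  have s := (hL p₀ p₁ hp₀ hE₀ hp₁ hE₁).trans (hL' j₀ j₁ hj₀ hE₀ hj₁ hF₁)
  rw [hker, hrange] at s
  have hN : ∀ q : LinearMap.ker (idemSum ex x e hxe), ∑ i, q.1.1 i * x i = 0 := fun q =>
    congrFun (congrArg Subtype.val q.2) ()
  -- By `hrad` the second syzygy lies in the radical of the projective containing it, so it is a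
  -- genuine quotient of the second cosyzygy.
  obtain ⟨g, hg⟩ := s.exists_surjective hA J hJ (Submodule.subtype _)
    (Submodule.injective_subtype _) (by
      intro q
      rw [Submodule.subtype_apply, idemSubmodule_eq_sum ex hex q.1]
      exact sum_mem fun i _ => Submodule.smul_mem_smul (hrad q.1.1 q.1.2 (hN q) i) Submodule.mem_top)
  -- `G` is this surjection precomposed with the quotient map from `⨁ A (ey k)`; the rows of the
  -- matrix are the images of its standard generators.
  obtain ⟨G, hGdef⟩ : ∃ G : idemSubmodule ey →ₗ[A] (ι → A), ∀ q, G q =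
      (g ((LinearMap.range (idemDiag ey y e hy)).mkQ q)).1.1 :=
    ⟨(Submodule.subtype _).comp ((Submodule.subtype _).comp (g.comp (Submodule.mkQ _))),
      fun _ => rfl⟩
  have hG : ∀ (q : idemSubmodule ey) (i : ι),
      G q i = ∑ k, q.1 k * G ⟨_, idemSubmodule_single_mem ey hey k⟩ i := fun q i => by
    conv_lhs => rw [idemSubmodule_eq_sum ey hey q, map_sum, Finset.sum_apply]
    exact Finset.sum_congr rfl fun k _ => by rw [map_smul]; rfl
  refine ⟨fun k => G ⟨_, idemSubmodule_single_mem ey hey k⟩, fun k i => ?_, fun k i => ?_,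
    fun k => ?_, fun i => ?_, fun q hq hqx => ?_⟩
  · beta_reduce
    rw [← smul_eq_mul, ← Pi.smul_apply, ← map_smul]
    refine congrArg (fun q => G q i) (Subtype.ext ?_)
    change ey k • Pi.single k (ey k) = Pi.single k (ey k)
    rw [← Pi.single_smul, smul_eq_mul, hey]
  · beta_reduce
    rw [hGdef]
    exact (g _).1.2 i
  · simp only [hGdef]
    exact hN (g _)
  · have h0 : G (idemDiag ey y e hy ⟨fun _ => e, fun _ => he⟩) = 0 := by
      rw [hGdef, Submodule.mkQ_apply, (Submodule.Quotient.mk_eq_zero _).2 (LinearMap.mem_range_self _ _),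
        map_zero]
      rfl
    have h1 := hG (idemDiag ey y e hy ⟨fun _ => e, fun _ => he⟩) i
    rw [h0] at h1
    refine Eq.trans (Finset.sum_congr rfl fun k _ => ?_) h1.symm
    change _ = e * y k * _
    rw [hye]
  · obtain ⟨t, ht⟩ := hg ⟨⟨q, hq⟩, Subtype.ext (funext fun _ => hqx)⟩
    obtain ⟨c, rfl⟩ := Submodule.mkQ_surjective _ t
    refine ⟨c.1, fun i => ?_⟩
    rw [← hG, hGdef, ht]

/-- Reindexing by `Fin` passes to arbitrary universes, since finite free retracts are indexed by
`Type`. -/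
theorem exists_syzygy_matrix [FiniteDimensional K A] (hsymm : IsSymmAlgebra K A)
    (hper : IsPeriodicAlgebra K A 4) (he : e * e = e) (hχe : χ e = 1)
    {ι κ : Type*} [Fintype ι] [Fintype κ]
    (x ex : ι → A) (hex : ∀ i, ex i * ex i = ex i) (hx : ∀ i, ex i * x i = x i)
    (hxe : ∀ i, x i * e = x i) (hxχ : ∀ i, χ (x i) = 0)
    (hxgen : ∀ p, p * e = p → χ p = 0 → ∃ q : ι → A, p = ∑ i, q i * x i)
    (y ey : κ → A) (hey : ∀ k, ey k * ey k = ey k) (hy : ∀ k, y k * ey k = y k)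
    (hye : ∀ k, e * y k = y k) (hyχ : ∀ k, χ (y k) = 0)
    (hygen : ∀ p, e * p = p → χ p = 0 → ∃ r : κ → A, p = ∑ k, y k * r k)
    (J : Ideal A) [J.IsTwoSided] {n : ℕ} (hJ : J ^ n = ⊥)
    (hrad : ∀ q : ι → A, (∀ i, q i * ex i = q i) → ∑ i, q i * x i = 0 → ∀ i, q i ∈ J) :
    ∃ φ : κ → ι → A, (∀ k i, ey k * φ k i = φ k i) ∧ (∀ k i, φ k i * ex i = φ k i) ∧
      (∀ k, ∑ i, φ k i * x i = 0) ∧ (∀ i, ∑ k, y k * φ k i = 0) ∧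
      ∀ q : ι → A, (∀ i, q i * ex i = q i) → ∑ i, q i * x i = 0 →
        ∃ c : κ → A, ∀ i, q i = ∑ k, c k * φ k i := by
  let f := Fintype.equivFin ι
  let g := Fintype.equivFin κ
  have hf : ∀ F : ι → A, ∑ i, F (f.symm i) = ∑ i, F i := fun F => f.symm.sum_comp F
  have hg : ∀ F : κ → A, ∑ k, F (g.symm k) = ∑ k, F k := fun F => g.symm.sum_comp F
  obtain ⟨φ, h1, h2, h3, h4, h5⟩ := exists_syzygy_matrix_of_type χ hsymm hper he hχe
    (x ∘ f.symm) (ex ∘ f.symm) (fun i => hex _) (fun i => hx _) (fun i => hxe _) (fun i => hxχ _)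
    (fun p hp hp' => by
      obtain ⟨q, hq⟩ := hxgen p hp hp'
      exact ⟨q ∘ f.symm, hq.trans (hf fun i => q i * x i).symm⟩)
    (y ∘ g.symm) (ey ∘ g.symm) (fun i => hey _) (fun i => hy _) (fun i => hye _) (fun i => hyχ _)
    (fun p hp hp' => by
      obtain ⟨r, hr⟩ := hygen p hp hp'
      exact ⟨r ∘ g.symm, hr.trans (hg fun i => y i * r i).symm⟩)
    J hJ (fun q hq hq' i => by
      have := hrad (q ∘ f) (fun i => by simpa using hq (f i))
        (by rw [← hf]; simpa using hq') (f.symm i)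
      simpa using this)
  refine ⟨fun k i => φ (g k) (f i), fun k i => by simpa using h1 (g k) (f i),
    fun k i => by simpa using h2 (g k) (f i), fun k => ?_, fun i => ?_, fun q hq hq' => ?_⟩
  · rw [← hf]
    simpa using h3 (g k)
  · rw [← hg]
    simpa using h4 (f i)
  · obtain ⟨c, hc⟩ := h5 (q ∘ f.symm) (fun i => hq _) ((hf fun i => q i * x i).trans hq')
    refine ⟨c ∘ g, fun i => ?_⟩
    rw [← hg]
    simpa using hc (f i)

end Periodic

/-! ### Coefficients of short paths -/

namespace PathAlgebra

section Coefficients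

variable {K : Type u} {V : Type v} [Field K] [Quiver.{w} V]

/-- The coefficient of a path, as a linear functional. -/
def coeffHom (K : Type u) {V : Type v} [Field K] [Quiver.{w} V] (p : Quiver.AnyPath V) :
    PathAlgebra K V →ₗ[K] K :=
  Finsupp.lapply p

theorem coeffHom_ofPath_self {a b : V} (p : Quiver.Path a b) :
    coeffHom K ⟨a, b, p⟩ (ofPath K p) = 1 := Finsupp.single_eq_same

theorem coeffHom_ofPath_of_ne {a b : V} (p : Quiver.Path a b) {q : Quiver.AnyPath V}
    (h : (⟨a, b, p⟩ : Quiver.AnyPath V) ≠ q) : coeffHom K q (ofPath K p) = 0 :=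
  Finsupp.single_eq_of_ne' h

/-- The coefficient of the trivial path at a vertex. -/
def vertexCoeff (K : Type u) {V : Type v} [Field K] [Quiver.{w} V] (a : V) :
    PathAlgebra K V →ₗ[K] K :=
  coeffHom K ⟨a, a, Quiver.Path.nil⟩

/-- The coefficient of an arrow. -/
def arrowCoeff (K : Type u) {V : Type v} [Field K] [Quiver.{w} V] {a b : V} (f : a ⟶ b) :
    PathAlgebra K V →ₗ[K] K :=
  coeffHom K ⟨a, b, f.toPath⟩

theorem vertexCoeff_nil_self (a : V) :
    vertexCoeff K a (ofPath K (Quiver.Path.nil : Quiver.Path a a)) = 1 := coeffHom_ofPath_self _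

theorem vertexCoeff_nil_of_ne {a b : V} (h : b ≠ a) :
    vertexCoeff K a (ofPath K (Quiver.Path.nil : Quiver.Path b b)) = 0 :=
  coeffHom_ofPath_of_ne _ fun e => h (congrArg Sigma.fst e)

theorem vertexCoeff_cons (a : V) {b c d : V} (p : Quiver.Path b c) (f : c ⟶ d) :
    vertexCoeff K a (ofPath K (p.cons f)) = 0 :=
  coeffHom_ofPath_of_ne _ fun e => by
    have := congrArg (fun r : Quiver.AnyPath V => r.2.2.length) e
    simp at this

theorem arrowCoeff_nil {a b c : V} (f : a ⟶ b) :
    arrowCoeff K f (ofPath K (Quiver.Path.nil : Quiver.Path c c)) = 0 :=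
  coeffHom_ofPath_of_ne _ fun e => by
    have := congrArg (fun r : Quiver.AnyPath V => r.2.2.length) e
    simp at this

theorem arrowCoeff_of_source_ne {a b c d : V} (f : a ⟶ b) (p : Quiver.Path c d) (h : c ≠ a) :
    arrowCoeff K f (ofPath K p) = 0 :=
  coeffHom_ofPath_of_ne _ fun e => h (congrArg Sigma.fst e)

theorem arrowCoeff_of_target_ne {a b c d : V} (f : a ⟶ b) (p : Quiver.Path c d) (h : d ≠ b) :
    arrowCoeff K f (ofPath K p) = 0 :=
  coeffHom_ofPath_of_ne _ fun e => h (congrArg (fun r : Quiver.AnyPath V => r.2.1) e)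

theorem arrowCoeff_of_two_le {a b c d : V} (f : a ⟶ b) (p : Quiver.Path c d) (h : 2 ≤ p.length) :
    arrowCoeff K f (ofPath K p) = 0 :=
  coeffHom_ofPath_of_ne _ fun e => by
    have := congrArg (fun r : Quiver.AnyPath V => r.2.2.length) e
    simp only [Quiver.Path.length_toPath] at this
    omega

theorem arrowCoeff_self {a b : V} (f : a ⟶ b) : arrowCoeff K f (ofPath K f.toPath) = 1 :=
  coeffHom_ofPath_self _

theorem arrowCoeff_costar_of_ne {a : V} {f g : Quiver.Costar a} (h : g ≠ f) :
    arrowCoeff K f.2 (ofPath K g.2.toPath) = 0 :=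
  coeffHom_ofPath_of_ne _ fun e => h (by
    obtain ⟨b, f⟩ := f
    obtain ⟨c, g⟩ := g
    obtain rfl : c = b := congrArg Sigma.fst e
    simp only [Sigma.mk.injEq, heq_eq_eq, true_and] at e
    exact congrArg _ (eq_of_heq (Quiver.Path.hom_heq_of_cons_eq_cons e)))

theorem arrowCoeff_star_of_ne {a : V} {f g : Quiver.Star a} (h : g ≠ f) :
    arrowCoeff K f.2 (ofPath K g.2.toPath) = 0 :=
  coeffHom_ofPath_of_ne _ fun e => h (by
    obtain ⟨b, f⟩ := f
    obtain ⟨c, g⟩ := g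
    obtain rfl : c = b := congrArg (fun r : Quiver.AnyPath V => r.2.1) e
    simp only [Sigma.mk.injEq, heq_eq_eq, true_and] at e
    exact congrArg _ (eq_of_heq (Quiver.Path.hom_heq_of_cons_eq_cons e)))

theorem vertexCoeff_vertexIdem_self (a : V) : vertexCoeff K a (vertexIdem K a) = 1 :=
  vertexCoeff_nil_self a

theorem vertexCoeff_vertexIdem_of_ne {a b : V} (h : b ≠ a) :
    vertexCoeff K a (vertexIdem K b) = 0 :=
  vertexCoeff_nil_of_ne h

theorem ofPath_toPath_mem_arrowIdeal {a b : V} (f : a ⟶ b) :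
    ofPath K f.toPath ∈ arrowIdeal K V :=
  Submodule.subset_span ⟨a, b, f.toPath, le_rfl, rfl⟩

theorem vertexCoeff_eq_zero_of_mem {x : PathAlgebra K V} (hx : x ∈ arrowIdeal K V) (a : V) :
    vertexCoeff K a x = 0 := by
  induction hx using Submodule.span_induction with
  | zero => exact map_zero _
  | add x y _ _ hx hy => rw [map_add, hx, hy, add_zero]
  | smul k x _ hx => rw [map_smul, hx, smul_zero]
  | mem x hx =>
    obtain ⟨b, c, p, hp, rfl⟩ := hx
    cases p with
    | nil => simp at hp
    | cons p f => exact vertexCoeff_cons _ _ _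

variable [Fintype V]

theorem ofPath_mul_ofPath {a b c : V} (p : Quiver.Path a b) (q : Quiver.Path b c) :
    ofPath K p * ofPath K q = ofPath K (p.comp q) := mulHom_comp p q

theorem ofPath_mul_ofPath_of_ne {a b c d : V} (p : Quiver.Path a b) (q : Quiver.Path c d)
    (h : b ≠ c) : ofPath K p * ofPath K q = 0 := mulHom_ne p q h

theorem vertexCoeff_mul (a : V) (x y : PathAlgebra K V) :
    vertexCoeff K a (x * y) = vertexCoeff K a x * vertexCoeff K a y := by
  induction x using induction_on with
  | zero => simp
  | add x x' hx hx' => simp only [add_mul, map_add, hx, hx']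
  | smul k p =>
    induction y using induction_on with
    | zero => simp
    | add y y' hy hy' => simp only [mul_add, map_add, hy, hy']
    | smul l q =>
      rename_i b c d e
      simp only [smul_mul_assoc, mul_smul_comm, map_smul, smul_eq_mul]
      suffices vertexCoeff K a (ofPath K p * ofPath K q) =
          vertexCoeff K a (ofPath K p) * vertexCoeff K a (ofPath K q) by rw [this]; ring
      cases q with
      | nil =>
        by_cases h : c = d
        · subst h
          rw [ofPath_mul_ofPath, Quiver.Path.comp_nil]
          cases p with
          | nil =>
            by_cases h : b = a
            · subst h
              rw [vertexCoeff_nil_self, mul_one]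
            · rw [vertexCoeff_nil_of_ne h, mul_zero]
          | cons p f => rw [vertexCoeff_cons, zero_mul]
        · rw [ofPath_mul_ofPath_of_ne _ _ h, map_zero]
          cases p with
          | nil =>
            by_cases h' : b = a
            · subst h'
              rw [vertexCoeff_nil_of_ne (Ne.symm h), mul_zero]
            · rw [vertexCoeff_nil_of_ne h', zero_mul]
          | cons p f => rw [vertexCoeff_cons, zero_mul]
      | cons q f =>
        rw [vertexCoeff_cons, mul_zero]
        by_cases h : c = d
        · subst h
          rw [ofPath_mul_ofPath, Quiver.Path.comp_cons, vertexCoeff_cons]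
        · rw [ofPath_mul_ofPath_of_ne _ _ h, map_zero]

/-- A path of length one factors only as a trivial path times an arrow, on either side. So an arrow
coefficient is a derivation twisted by the characters of its two ends. -/
theorem arrowCoeff_mul {a b : V} (f : a ⟶ b) (x y : PathAlgebra K V) :
    arrowCoeff K f (x * y) =
      vertexCoeff K a x * arrowCoeff K f y + arrowCoeff K f x * vertexCoeff K b y := by
  induction x using induction_on with
  | zero => simp
  | add x x' hx hx' => simp only [add_mul, map_add, hx, hx']; ring
  | smul k p =>
    induction y using induction_on with
    | zero => simp
    | add y y' hy hy' => simp only [mul_add, map_add, hy, hy']; ring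
    | smul l q =>
      rename_i c d c' d'
      simp only [smul_mul_assoc, mul_smul_comm, map_smul, smul_eq_mul]
      suffices arrowCoeff K f (ofPath K p * ofPath K q) =
          vertexCoeff K a (ofPath K p) * arrowCoeff K f (ofPath K q) +
            arrowCoeff K f (ofPath K p) * vertexCoeff K b (ofPath K q) by rw [this]; ring
      cases p with
      | nil =>
        rw [arrowCoeff_nil, zero_mul, add_zero]
        by_cases h : c = c'
        · subst h
          rw [ofPath_mul_ofPath, Quiver.Path.nil_comp]
          by_cases h : c = a
          · subst h
            rw [vertexCoeff_nil_self, one_mul]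
          · rw [vertexCoeff_nil_of_ne h, zero_mul, arrowCoeff_of_source_ne _ _ h]
        · rw [ofPath_mul_ofPath_of_ne _ _ h, map_zero]
          by_cases h' : c = a
          · subst h'
            rw [arrowCoeff_of_source_ne _ _ (Ne.symm h), mul_zero]
          · rw [vertexCoeff_nil_of_ne h', zero_mul]
      | cons p g =>
        rw [vertexCoeff_cons, zero_mul, zero_add]
        cases q with
        | nil =>
          by_cases h : d = c'
          · subst h
            rw [ofPath_mul_ofPath, Quiver.Path.comp_nil]
            by_cases h : d = b
            · subst h
              rw [vertexCoeff_nil_self, mul_one]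
            · rw [vertexCoeff_nil_of_ne h, mul_zero, arrowCoeff_of_target_ne _ _ h]
          · rw [ofPath_mul_ofPath_of_ne _ _ h, map_zero]
            by_cases h' : c' = b
            · subst h'
              rw [arrowCoeff_of_target_ne _ _ h, zero_mul]
            · rw [vertexCoeff_nil_of_ne h', mul_zero]
        | cons q g' =>
          rw [vertexCoeff_cons, mul_zero]
          by_cases h : d = c'
          · subst h
            rw [ofPath_mul_ofPath]
            exact arrowCoeff_of_two_le _ _ (by
              simp only [Quiver.Path.length_comp, Quiver.Path.length_cons]; omega)
          · rw [ofPath_mul_ofPath_of_ne _ _ h, map_zero]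

theorem one_eq_sum_vertexIdem : (1 : PathAlgebra K V) = ∑ a : V, vertexIdem K a := rfl

theorem vertexCoeff_one (a : V) : vertexCoeff K a (1 : PathAlgebra K V) = 1 := by
  rw [one_eq_sum_vertexIdem, map_sum, Finset.sum_eq_single a, vertexCoeff_vertexIdem_self]
  · exact fun b _ hb => vertexCoeff_vertexIdem_of_ne hb
  · exact fun h => absurd (Finset.mem_univ a) h

/-- For this reason the coefficients of vertices and arrows descend to quotients by ideals contained
in `R ^ 2`. -/
theorem coeff_eq_zero_of_mem_sq {x : PathAlgebra K V} (hx : x ∈ arrowIdeal K V ^ 2) :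
    (∀ a, vertexCoeff K a x = 0) ∧ ∀ {a b : V} (f : a ⟶ b), arrowCoeff K f x = 0 := by
  rw [sq] at hx
  induction hx using Submodule.mul_induction_on' with
  | mem_mul_mem x hx y hy =>
    refine ⟨fun a => ?_, fun f => ?_⟩
    · rw [vertexCoeff_mul, vertexCoeff_eq_zero_of_mem hx, zero_mul]
    · rw [arrowCoeff_mul, vertexCoeff_eq_zero_of_mem hx, vertexCoeff_eq_zero_of_mem hy, zero_mul,
        mul_zero, add_zero]
  | add x _ y _ hx hy =>
    exact ⟨fun a => by rw [map_add, hx.1, hy.1, add_zero],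
      fun f => by rw [map_add, hx.2, hy.2, add_zero]⟩

theorem sum_mul_vertexIdem (x : PathAlgebra K V) : x = ∑ a, x * vertexIdem K a := by
  rw [← Finset.mul_sum, ← one_eq_sum_vertexIdem, mul_one]

noncomputable instance [∀ a b : V, Finite (a ⟶ b)] (a : V) : Fintype (Quiver.Costar a) :=
  have : Finite (Quiver.Costar a) := inferInstanceAs (Finite (Σ b, b ⟶ a))
  Fintype.ofFinite _

noncomputable instance [∀ a b : V, Finite (a ⟶ b)] (a : V) : Fintype (Quiver.Star a) :=
  have : Finite (Quiver.Star a) := inferInstanceAs (Finite (Σ b, a ⟶ b))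
  Fintype.ofFinite _

variable [∀ a b : V, Finite (a ⟶ b)]

/-! ### Splitting off arrows, and finite codimension. -/

/-- Splitting off the last arrow of the paths which end at a vertex. -/
theorem exists_last_arrow (a : V) (x : PathAlgebra K V) :
    ∃ q : Quiver.Costar a → PathAlgebra K V,
      x * vertexIdem K a = vertexCoeff K a x • vertexIdem K a +
        ∑ f, q f * ofPath K f.2.toPath ∧
      ∀ (f : Quiver.Costar a) (c : V) (p : Quiver.Path c f.1),
        coeffHom K ⟨c, f.1, p⟩ (q f) = coeffHom K ⟨c, a, p.cons f.2⟩ x := by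
  classical
  induction x using induction_on with
  | zero => exact ⟨0, by simp, by simp⟩
  | add x y hx hy =>
    obtain ⟨q, hq, hq'⟩ := hx
    obtain ⟨r, hr, hr'⟩ := hy
    refine ⟨q + r, ?_, fun f c p => ?_⟩
    · simp only [add_mul, hq, hr, map_add, add_smul, Pi.add_apply, Finset.sum_add_distrib]
      abel
    · rw [Pi.add_apply, map_add, map_add, hq', hr']
  | smul k p =>
    rename_i c d
    by_cases h : d = a
    · subst h
      rw [smul_mul_assoc, vertexIdem, ofPath_mul_ofPath, Quiver.Path.comp_nil]
      cases p with
      | nil =>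
        refine ⟨0, by simp [vertexCoeff_nil_self], fun f b p => ?_⟩
        rw [map_smul, coeffHom_ofPath_of_ne, smul_zero]
        · simp
        · intro e
          have := congrArg (fun r : Quiver.AnyPath V => r.2.2.length) e
          simp at this
      | cons p g =>
        rename_i b
        refine ⟨Pi.single ⟨b, g⟩ (k • ofPath K p), ?_, ?_⟩
        · rw [map_smul, vertexCoeff_cons, smul_zero, zero_smul, zero_add,
            Finset.sum_eq_single ⟨b, g⟩]
          · rw [Pi.single_eq_same, smul_mul_assoc, ofPath_mul_ofPath]
            rfl
          · intro f _ hf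
            rw [Pi.single_eq_of_ne hf, zero_mul]
          · exact fun h => absurd (Finset.mem_univ _) h
        · intro f c' p'
          rw [map_smul]
          by_cases hf : f = ⟨b, g⟩
          · subst hf
            rw [Pi.single_eq_same, map_smul]
            congr 1
            by_cases hp : (⟨c, b, p⟩ : Quiver.AnyPath V) = ⟨c', b, p'⟩
            · obtain rfl : c = c' := congrArg Sigma.fst hp
              simp only [Sigma.mk.injEq, heq_eq_eq, true_and] at hp
              subst hp
              rw [coeffHom_ofPath_self, coeffHom_ofPath_self]
            · rw [coeffHom_ofPath_of_ne _ hp, coeffHom_ofPath_of_ne]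
              intro e
              obtain rfl : c = c' := congrArg Sigma.fst e
              simp only [Sigma.mk.injEq, heq_eq_eq, true_and] at e
              exact hp (by rw [eq_of_heq (Quiver.Path.heq_of_cons_eq_cons e)])
          · rw [Pi.single_eq_of_ne hf, map_zero, coeffHom_ofPath_of_ne, smul_zero]
            intro e
            obtain rfl : c = c' := congrArg Sigma.fst e
            simp only [Sigma.mk.injEq, heq_eq_eq, true_and] at e
            obtain ⟨b', g'⟩ := f
            obtain rfl : b = b' := Quiver.Path.obj_eq_of_cons_eq_cons e
            exact hf (by rw [eq_of_heq (Quiver.Path.hom_heq_of_cons_eq_cons e)])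
    · refine ⟨0, ?_, fun f b p' => ?_⟩
      · rw [smul_mul_assoc, vertexIdem, ofPath_mul_ofPath_of_ne _ _ h, map_smul, vertexCoeff,
          coeffHom_ofPath_of_ne]
        · simp
        · exact fun e => h (congrArg (fun r : Quiver.AnyPath V => r.2.1) e)
      · rw [map_smul, coeffHom_ofPath_of_ne]
        · simp
        · exact fun e => h (congrArg (fun r : Quiver.AnyPath V => r.2.1) e)

/-- Splitting off the first arrow of the paths which start at a vertex. -/
theorem exists_first_arrow (a : V) (x : PathAlgebra K V) :
    ∃ q : Quiver.Star a → PathAlgebra K V,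
      vertexIdem K a * x = vertexCoeff K a x • vertexIdem K a +
        ∑ f, ofPath K f.2.toPath * q f := by
  classical
  induction x using induction_on with
  | zero => exact ⟨0, by simp⟩
  | add x y hx hy =>
    obtain ⟨q, hq⟩ := hx
    obtain ⟨r, hr⟩ := hy
    refine ⟨q + r, ?_⟩
    simp only [mul_add, hq, hr, map_add, add_smul, Pi.add_apply, Finset.sum_add_distrib]
    abel
  | smul k p =>
    rename_i c d
    by_cases h : c = a
    · subst h
      suffices ∃ q : Quiver.Star c → PathAlgebra K V, ofPath K p =
          vertexCoeff K c (ofPath K p) • vertexIdem K c + ∑ f, ofPath K f.2.toPath * q f by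
        obtain ⟨q, hq⟩ := this
        refine ⟨k • q, ?_⟩
        rw [map_smul, smul_eq_mul, mul_smul, mul_smul_comm]
        simp only [Pi.smul_apply, mul_smul_comm]
        rw [← Finset.smul_sum, ← smul_add, ← hq, vertexIdem, ofPath_mul_ofPath,
          Quiver.Path.nil_comp]
      induction p with
      | nil => exact ⟨0, by rw [vertexCoeff_nil_self]; simp [vertexIdem]⟩
      | cons p g ih =>
        rename_i b d
        simp only [vertexCoeff_cons, zero_smul, zero_add]
        cases p with
        | nil =>
          refine ⟨Pi.single ⟨d, g⟩ (vertexIdem K d), ?_⟩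
          rw [Finset.sum_eq_single ⟨d, g⟩]
          · rw [Pi.single_eq_same, vertexIdem, ofPath_mul_ofPath]
            rfl
          · intro f _ hf
            rw [Pi.single_eq_of_ne hf, mul_zero]
          · exact fun h => absurd (Finset.mem_univ _) h
        | cons p g' =>
          obtain ⟨q, hq⟩ := ih
          rw [vertexCoeff_cons, zero_smul, zero_add] at hq
          refine ⟨fun f => q f * ofPath K g.toPath, ?_⟩
          have h1 : ofPath K ((p.cons g').cons g) = ofPath K (p.cons g') * ofPath K g.toPath :=
            (ofPath_mul_ofPath (p.cons g') g.toPath).symm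
          rw [h1, hq, Finset.sum_mul]
          simp only [mul_assoc]
    · refine ⟨0, ?_⟩
      rw [mul_smul_comm, vertexIdem, ofPath_mul_ofPath_of_ne _ _ (Ne.symm h), map_smul, vertexCoeff,
        coeffHom_ofPath_of_ne]
      · simp
      · exact fun e => h (congrArg Sigma.fst e)

/-- Every element is the sum of a combination of trivial paths and products `q * f` with
arrows `f`. -/
theorem exists_decomposition (x : PathAlgebra K V) :
    ∃ q : (Σ a : V, Quiver.Costar a) → PathAlgebra K V,
      x = ∑ a, vertexCoeff K a x • vertexIdem K a + ∑ f, q f * ofPath K f.2.2.toPath := by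
  choose q hq _ using fun a => exists_last_arrow a x
  refine ⟨fun f => q f.1 f.2, ?_⟩
  rw [Fintype.sum_sigma, ← Finset.sum_add_distrib]
  conv_lhs => rw [sum_mul_vertexIdem x]
  exact Finset.sum_congr rfl fun a _ => hq a

theorem mem_arrowIdeal_of_vertexCoeff {x : PathAlgebra K V} (hx : ∀ a, vertexCoeff K a x = 0) :
    x ∈ arrowIdeal K V := by
  have hle : ∀ y : PathAlgebra K V, ∀ z ∈ arrowIdeal K V, y * z ∈ arrowIdeal K V := by
    intro y z hz
    induction hz using Submodule.span_induction with
    | zero => rw [mul_zero]; exact zero_mem _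
    | add z z' _ _ hz hz' => rw [mul_add]; exact add_mem hz hz'
    | smul k z _ hz => rw [mul_smul_comm]; exact Submodule.smul_mem _ _ hz
    | mem z hz =>
      obtain ⟨b, c, p, hp, rfl⟩ := hz
      induction y using induction_on with
      | zero => rw [zero_mul]; exact zero_mem _
      | add y y' hy hy' => rw [add_mul]; exact add_mem hy hy'
      | smul k q =>
        rename_i b' c'
        rw [smul_mul_assoc]
        refine Submodule.smul_mem _ _ ?_
        by_cases h : c' = b
        · subst h
          rw [ofPath_mul_ofPath]
          exact Submodule.subset_span ⟨_, _, _, by rw [Quiver.Path.length_comp]; omega, rfl⟩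
        · rw [ofPath_mul_ofPath_of_ne _ _ h]
          exact zero_mem _
  obtain ⟨q, hq⟩ := exists_decomposition x
  rw [hq]
  simp only [hx, zero_smul, Finset.sum_const_zero, zero_add]
  exact sum_mem fun f _ => hle _ _ (ofPath_toPath_mem_arrowIdeal _)

/-- Used for the finite dimension of the quotient. If `W` complements `R ^ (n + 1)`, then the
trivial paths together with the `W f`, for all arrows `f`, complement `R ^ (n + 2)`. -/
theorem exists_finite_complement (n : ℕ) :
    ∃ W : Submodule K (PathAlgebra K V), FiniteDimensional K W ∧ W ⊔ arrowIdeal K V ^ (n + 1) = ⊤ := by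
  have hidem : FiniteDimensional K (Submodule.span K (Set.range fun a : V => vertexIdem K a)) :=
    FiniteDimensional.span_of_finite K (Set.finite_range _)
  have hmem : ∀ x : PathAlgebra K V, ∑ a, vertexCoeff K a x • vertexIdem K a ∈
      Submodule.span K (Set.range fun a : V => vertexIdem K a) := fun x =>
    sum_mem fun a _ => Submodule.smul_mem _ _ (Submodule.subset_span ⟨a, rfl⟩)
  induction n with
  | zero =>
    refine ⟨_, hidem, top_le_iff.1 fun x _ => ?_⟩
    rw [zero_add, pow_one]
    refine Submodule.mem_sup.2 ⟨_, hmem x, x - ∑ a, vertexCoeff K a x • vertexIdem K a,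
      mem_arrowIdeal_of_vertexCoeff fun b => ?_, add_sub_cancel _ _⟩
    rw [map_sub, map_sum, Finset.sum_eq_single b]
    · rw [map_smul, vertexCoeff_vertexIdem_self, smul_eq_mul, mul_one, sub_self]
    · intro a _ ha
      rw [map_smul, vertexCoeff_vertexIdem_of_ne ha, smul_zero]
    · exact fun h => absurd (Finset.mem_univ _) h
  | succ n ih =>
    obtain ⟨W, hW, hW'⟩ := ih
    refine ⟨Submodule.span K (Set.range fun a : V => vertexIdem K a) ⊔
      ⨆ f : (Σ a : V, Quiver.Costar a),
        W.map (LinearMap.mulRight K (ofPath K f.2.2.toPath)), inferInstance,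
      top_le_iff.1 fun x _ => ?_⟩
    obtain ⟨q, hq⟩ := exists_decomposition x
    rw [hq]
    refine add_mem (Submodule.mem_sup_left (Submodule.mem_sup_left (hmem x)))
      (sum_mem fun f _ => ?_)
    have h1 : q f ∈ W ⊔ arrowIdeal K V ^ (n + 1) := hW' ▸ Submodule.mem_top
    obtain ⟨y, hy, z, hz, hyz⟩ := Submodule.mem_sup.1 h1
    rw [← hyz, add_mul]
    refine add_mem (Submodule.mem_sup_left (Submodule.mem_sup_right
      (Submodule.mem_iSup_of_mem f ⟨y, hy, rfl⟩))) (Submodule.mem_sup_right ?_)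
    rw [pow_succ]
    exact Submodule.mul_mem_mul hz (ofPath_toPath_mem_arrowIdeal _)

end Coefficients

end PathAlgebra

/-! ### Algebras with a presentation by a quiver -/

/-- Elements `eₐ` and `arr f` of an algebra, for the vertices and arrows of a quiver, with the
functionals which give the coefficients of the `eₐ` and of the `arr f`. -/
structure QuiverCoordinates (K : Type u) (V : Type v) (A : Type*) [Field K] [Fintype V]
    [Quiver.{w} V] [∀ a b : V, Finite (a ⟶ b)] [Ring A] [Algebra K A] where
  e : V → A
  arr : ∀ {a b : V}, (a ⟶ b) → A
  χ : V → A →ₐ[K] K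
  D : ∀ {a b : V}, (a ⟶ b) → A →ₗ[K] K
  idem : ∀ a, e a * e a = e a
  orth : ∀ {a b}, a ≠ b → e a * e b = 0
  e_arr : ∀ {a b : V} (f : a ⟶ b), e a * arr f = arr f
  arr_e : ∀ {a b : V} (f : a ⟶ b), arr f * e b = arr f
  χ_self : ∀ a, χ a (e a) = 1
  χ_ne : ∀ {a b}, b ≠ a → χ a (e b) = 0
  χ_arr : ∀ (c : V) {a b : V} (f : a ⟶ b), χ c (arr f) = 0
  D_mul : ∀ {a b : V} (f : a ⟶ b) (x y : A), D f (x * y) = χ a x * D f y + D f x * χ b y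
  D_e : ∀ {a b : V} (f : a ⟶ b) (c : V), D f (e c) = 0
  D_self : ∀ {a b : V} (f : a ⟶ b), D f (arr f) = 1
  D_costar : ∀ {a : V} {f g : Quiver.Costar a}, g ≠ f → D f.2 (arr g.2) = 0
  D_star : ∀ {a : V} {f g : Quiver.Star a}, g ≠ f → D f.2 (arr g.2) = 0
  last : ∀ (a : V) (x : A), χ a x = 0 →
    ∃ q : Quiver.Costar a → A, x * e a = ∑ f, q f * arr f.2
  first : ∀ (a : V) (x : A), χ a x = 0 →
    ∃ q : Quiver.Star a → A, e a * x = ∑ f, arr f.2 * q f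

namespace QuiverCoordinates

variable {K : Type u} {V : Type v} {A : Type*} [Field K] [Fintype V]
    [Quiver.{w} V] [∀ a b : V, Finite (a ⟶ b)] [Ring A] [Algebra K A]
    (Q : QuiverCoordinates K V A)

/-- The ideal of the elements without trivial paths. -/
def rad : Ideal A where
  carrier := {x | ∀ a, Q.χ a x = 0}
  add_mem' hx hy a := by rw [map_add, hx a, hy a, add_zero]
  zero_mem' a := map_zero _
  smul_mem' c x hx a := by rw [smul_eq_mul, map_mul, hx a, mul_zero]

instance : Q.rad.IsTwoSided := ⟨fun y hx a => by rw [map_mul, hx a, zero_mul]⟩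

theorem χ_of_mul_e_ne {x : A} {a b : V} (hx : x * Q.e b = x) (h : b ≠ a) : Q.χ a x = 0 := by
  rw [← hx, map_mul, Q.χ_ne h, mul_zero]

theorem χ_of_e_mul_ne {x : A} {a b : V} (hx : Q.e b * x = x) (h : b ≠ a) : Q.χ a x = 0 := by
  rw [← hx, map_mul, Q.χ_ne h, zero_mul]

theorem mem_rad_of_mul_e {x : A} {a : V} (hx : x * Q.e a = x) (h : Q.χ a x = 0) : x ∈ Q.rad :=
  fun b => by
    by_cases hb : a = b
    · exact hb ▸ h
    · exact Q.χ_of_mul_e_ne hx hb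

theorem mem_rad_of_e_mul {x : A} {a : V} (hx : Q.e a * x = x) (h : Q.χ a x = 0) : x ∈ Q.rad :=
  fun b => by
    by_cases hb : a = b
    · exact hb ▸ h
    · exact Q.χ_of_e_mul_ne hx hb

theorem D_of_e_mul_ne {x : A} {a b c : V} (f : a ⟶ b) (hx : Q.e c * x = x) (h : c ≠ a) :
    Q.D f x = 0 := by
  rw [← hx, Q.D_mul, Q.χ_ne h, Q.D_e, zero_mul, zero_mul, add_zero]

theorem D_mul_arr {a b : V} (f : a ⟶ b) (x : A) : Q.D f (x * Q.arr f) = Q.χ a x := by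
  rw [Q.D_mul, Q.D_self, Q.χ_arr, mul_one, mul_zero, add_zero]

theorem D_arr_mul {a b : V} (f : a ⟶ b) (x : A) : Q.D f (Q.arr f * x) = Q.χ b x := by
  rw [Q.D_mul, Q.D_self, Q.χ_arr, zero_mul, one_mul, zero_add]

theorem D_mul_arr_of_ne {a : V} {f g : Quiver.Costar a} (h : g ≠ f) (x : A) :
    Q.D f.2 (x * Q.arr g.2) = 0 := by
  rw [Q.D_mul, Q.D_costar h, Q.χ_arr, mul_zero, mul_zero, add_zero]

theorem D_arr_mul_of_ne {a : V} {f g : Quiver.Star a} (h : g ≠ f) (x : A) :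
    Q.D f.2 (Q.arr g.2 * x) = 0 := by
  rw [Q.D_mul, Q.D_star h, Q.χ_arr, zero_mul, zero_mul, add_zero]

theorem D_mul_e {a b : V} (f : a ⟶ b) (x : A) : Q.D f (x * Q.e b) = Q.D f x := by
  rw [Q.D_mul, Q.D_e, Q.χ_self, mul_zero, mul_one, zero_add]

/-- Linear independence of the arrows modulo the square of the radical enters through this formula,
which reads off the constant term of one left coefficient. -/
theorem D_sum_mul_arr {a : V} (f : Quiver.Costar a) (q : Quiver.Costar a → A) :
    Q.D f.2 (∑ g, q g * Q.arr g.2) = Q.χ f.1 (q f) := by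
  rw [map_sum, Finset.sum_eq_single f, Q.D_mul_arr]
  · exact fun g _ hg => Q.D_mul_arr_of_ne hg _
  · exact fun h => absurd (Finset.mem_univ _) h

theorem D_sum_arr_mul {a : V} (f : Quiver.Star a) (q : Quiver.Star a → A) :
    Q.D f.2 (∑ g, Q.arr g.2 * q g) = Q.χ f.1 (q f) := by
  rw [map_sum, Finset.sum_eq_single f, Q.D_arr_mul]
  · exact fun g _ hg => Q.D_arr_mul_of_ne hg _
  · exact fun h => absurd (Finset.mem_univ _) h

theorem exists_last {a : V} {x : A} (hx : x * Q.e a = x) (h : Q.χ a x = 0) :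
    ∃ q : Quiver.Costar a → A, (∀ f, q f * Q.e f.1 = q f) ∧ x = ∑ f, q f * Q.arr f.2 := by
  obtain ⟨q, hq⟩ := Q.last a x h
  refine ⟨fun f => q f * Q.e f.1, fun f => by rw [mul_assoc, Q.idem], ?_⟩
  rw [← hx, hq]
  exact Finset.sum_congr rfl fun f _ => by rw [mul_assoc, Q.e_arr]

theorem exists_first {a : V} {x : A} (hx : Q.e a * x = x) (h : Q.χ a x = 0) :
    ∃ q : Quiver.Star a → A, (∀ f, Q.e f.1 * q f = q f) ∧ x = ∑ f, Q.arr f.2 * q f := by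
  obtain ⟨q, hq⟩ := Q.first a x h
  refine ⟨fun f => Q.e f.1 * q f, fun f => by rw [← mul_assoc, Q.idem], ?_⟩
  rw [← hx, hq]
  exact Finset.sum_congr rfl fun f _ => by rw [← mul_assoc, Q.arr_e]

/-! ### Relations at a vertex and their generating matrix. -/

/-- A family `q` with `∑ q f * arr f = 0`, over the arrows which end at a vertex. -/
def IsRelation {a : V} (q : Quiver.Costar a → A) : Prop :=
  (∀ f, q f * Q.e f.1 = q f) ∧ ∑ f, q f * Q.arr f.2 = 0

theorem IsRelation.mem_rad {Q : QuiverCoordinates K V A} {a : V} {q : Quiver.Costar a → A}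
    (h : Q.IsRelation q) (f : Quiver.Costar a) : q f ∈ Q.rad :=
  Q.mem_rad_of_mul_e (h.1 f) (by rw [← Q.D_sum_mul_arr, h.2, map_zero])

/-- A matrix of generators of the relations at a vertex, whose rows and columns are orthogonal to
the arrows. -/
structure IsRelationMatrix (a : V) (φ : Quiver.Star a → Quiver.Costar a → A) : Prop where
  e_mul : ∀ g f, Q.e g.1 * φ g f = φ g f
  rel : ∀ g, Q.IsRelation (φ g)
  dual : ∀ f, ∑ g, Q.arr g.2 * φ g f = 0
  gen : ∀ q, Q.IsRelation q → ∃ c : Quiver.Star a → A, ∀ f, q f = ∑ g, c g * φ g f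

/-- The arrows ending at `a` generate the radical of `A e_a`, those starting at `a` generate the
radical of `e_a A`, and `IsRelation.mem_rad` supplies the radical condition. -/
theorem exists_isRelationMatrix [FiniteDimensional K A] (hsymm : IsSymmAlgebra K A)
    (hper : IsPeriodicAlgebra K A 4) {n : ℕ} (hn : Q.rad ^ n = ⊥) (a : V) :
    ∃ φ, Q.IsRelationMatrix a φ := by
  obtain ⟨φ, h1, h2, h3, h4, h5⟩ := exists_syzygy_matrix (Q.χ a) hsymm hper (Q.idem a) (Q.χ_self a)
    (fun f : Quiver.Costar a => Q.arr f.2) (fun f => Q.e f.1) (fun f => Q.idem _)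
    (fun f => Q.e_arr _) (fun f => Q.arr_e _) (fun f => Q.χ_arr _ _)
    (fun p hp hp' => by
      obtain ⟨q, -, hq⟩ := Q.exists_last hp hp'
      exact ⟨q, hq⟩)
    (fun g : Quiver.Star a => Q.arr g.2) (fun g => Q.e g.1) (fun g => Q.idem _)
    (fun g => Q.arr_e _) (fun g => Q.e_arr _) (fun g => Q.χ_arr _ _)
    (fun p hp hp' => by
      obtain ⟨q, -, hq⟩ := Q.exists_first hp hp'
      exact ⟨q, hq⟩)
    Q.rad hn (fun q hq hq' => IsRelation.mem_rad ⟨hq, hq'⟩)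
  exact ⟨φ, h1, fun g => ⟨h2 g, h3 g⟩, h4, fun q hq => h5 q hq.1 hq.2⟩

/-- If the path `αβ` occurs in a relation, then there is an arrow from its target to its source,
whose generating relation contains `αβ`. -/
theorem IsRelationMatrix.exists_arrow {Q : QuiverCoordinates K V A} {j i k : V} (α : j ⟶ i)
    (β : i ⟶ k) {φ : Quiver.Star k → Quiver.Costar k → A} (hφ : Q.IsRelationMatrix k φ)
    {q : Quiver.Costar k → A} (hq : Q.IsRelation q) (hD : Q.D α (q ⟨i, β⟩) ≠ 0) :
    ∃ δ : k ⟶ j, Q.D α (φ ⟨j, δ⟩ ⟨i, β⟩) ≠ 0 := by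
  obtain ⟨c, hc⟩ := hφ.gen q hq
  rw [hc, map_sum] at hD
  obtain ⟨g, -, hg⟩ := Finset.exists_ne_zero_of_sum_ne_zero hD
  -- The entries of the matrix lie in the radical, so only the constant term of `c g` contributes to
  -- the coefficient of `α`. A nonzero contribution forces `g` to end at the source of `α`.
  rw [Q.D_mul, (hφ.rel g).mem_rad ⟨i, β⟩ i, mul_zero, add_zero] at hg
  obtain ⟨b, δ⟩ := g
  have hb : b = j := by
    by_contra h
    exact hg (by rw [Q.D_of_e_mul_ne α (hφ.e_mul _ _) h, mul_zero])
  subst hb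
  exact ⟨δ, right_ne_zero_of_mul hg⟩

/-! ### Annihilators of an arrow. -/

theorem exists_pow_left {j : V} (x : A)
    (h : ∀ f : Quiver.Costar j, ∃ r : Quiver.Costar j → A, (∀ g, r g ∈ Q.rad) ∧
      Q.arr f.2 * x = ∑ g, r g * Q.arr g.2 * x) (n : ℕ) (f : Quiver.Costar j) :
    ∃ r : Quiver.Costar j → A, (∀ g, r g ∈ Q.rad ^ n) ∧
      Q.arr f.2 * x = ∑ g, r g * Q.arr g.2 * x := by
  classical
  -- Substituting the relations into themselves moves the coefficients into ever higher powers of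
  -- the radical, which eventually vanish.
  choose ρ hρ hρ' using h
  induction n with
  | zero =>
    refine ⟨Pi.single f 1, fun g => by
      rw [Submodule.pow_zero, Ideal.one_eq_top]; exact Submodule.mem_top, ?_⟩
    rw [Finset.sum_eq_single f]
    · rw [Pi.single_eq_same, one_mul]
    · intro g _ hg
      rw [Pi.single_eq_of_ne hg, zero_mul, zero_mul]
    · exact fun h => absurd (Finset.mem_univ _) h
  | succ n ih =>
    obtain ⟨r, hr, hr'⟩ := ih
    refine ⟨fun g => ∑ g', r g' * ρ g' g, fun g => ?_, ?_⟩
    · rw [Ideal.IsTwoSided.pow_add, Submodule.pow_one]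
      exact sum_mem fun g' _ => Ideal.mul_mem_mul (hr g') (hρ g' g)
    · rw [hr']
      simp only [Finset.sum_mul]
      rw [Finset.sum_comm]
      refine Finset.sum_congr rfl fun g _ => ?_
      rw [mul_assoc, hρ', Finset.mul_sum]
      simp only [mul_assoc]

theorem exists_pow_right {j : V} (x : A)
    (h : ∀ f : Quiver.Star j, ∃ r : Quiver.Star j → A, (∀ g, r g ∈ Q.rad) ∧
      x * Q.arr f.2 = ∑ g, x * (Q.arr g.2 * r g)) (n : ℕ) (f : Quiver.Star j) :
    ∃ r : Quiver.Star j → A, (∀ g, r g ∈ Q.rad ^ n) ∧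
      x * Q.arr f.2 = ∑ g, x * (Q.arr g.2 * r g) := by
  classical
  choose ρ hρ hρ' using h
  induction n with
  | zero =>
    refine ⟨Pi.single f 1, fun g => by
      rw [Submodule.pow_zero, Ideal.one_eq_top]; exact Submodule.mem_top, ?_⟩
    rw [Finset.sum_eq_single f]
    · rw [Pi.single_eq_same, mul_one]
    · intro g _ hg
      rw [Pi.single_eq_of_ne hg, mul_zero, mul_zero]
    · exact fun h => absurd (Finset.mem_univ _) h
  | succ n ih =>
    obtain ⟨r, hr, hr'⟩ := ih
    refine ⟨fun g => ∑ g', ρ g' g * r g', fun g => ?_, ?_⟩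
    · rw [Ideal.IsTwoSided.pow_succ]
      exact sum_mem fun g' _ => Ideal.mul_mem_mul (hρ g' g) (hr g')
    · rw [hr']
      simp only [Finset.mul_sum]
      rw [Finset.sum_comm]
      refine Finset.sum_congr rfl fun g _ => ?_
      rw [← mul_assoc, hρ', Finset.sum_mul]
      simp only [mul_assoc]

/-- If the left annihilator of `x` contains a perturbation of every arrow which ends at `j`, then
it contains `rad * e j`. -/
theorem rad_mul_eq_zero {n : ℕ} (hn : Q.rad ^ n = ⊥) {j : V} {x : A} (hx : Q.e j * x = x)
    (h : ∀ f : Quiver.Costar j, ∃ w : A, w * x = 0 ∧ w * Q.e j = w ∧ w ∈ Q.rad ∧ Q.D f.2 w ≠ 0 ∧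
      ∀ g, g ≠ f → Q.D g.2 w = 0) {y : A} (hy : y ∈ Q.rad) : y * x = 0 := by
  classical
  have key : ∀ f : Quiver.Costar j, ∃ r : Quiver.Costar j → A, (∀ g, r g ∈ Q.rad) ∧
      Q.arr f.2 * x = ∑ g, r g * Q.arr g.2 * x := by
    intro f
    obtain ⟨w, hwx, hwe, hw, hwf, hwg⟩ := h f
    obtain ⟨q, hq, rfl⟩ := Q.exists_last hwe (hw j)
    rw [Q.D_sum_mul_arr] at hwf
    -- Rescale `w` so that `f` has coefficient one. Since `w x = 0`, the arrow `f` may be replaced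
    -- by `f - w` in front of `x`, and all left coefficients of `f - w` lie in the radical.
    refine ⟨fun g => (Pi.single f (Q.e f.1) : Quiver.Costar j → A) g - (Q.χ f.1 (q f))⁻¹ • q g,
      fun g => ?_, ?_⟩
    · by_cases hg : g = f
      · subst hg
        beta_reduce
        rw [Pi.single_eq_same]
        refine Q.mem_rad_of_mul_e (a := g.1) ?_ ?_
        · rw [sub_mul, Q.idem, smul_mul_assoc, hq]
        · rw [map_sub, map_smul, Q.χ_self, smul_eq_mul, inv_mul_cancel₀ hwf, sub_self]
      · beta_reduce
        rw [Pi.single_eq_of_ne hg, zero_sub]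
        refine Q.mem_rad_of_mul_e (a := g.1) ?_ ?_
        · rw [neg_mul, smul_mul_assoc, hq]
        · rw [map_neg, map_smul, ← Q.D_sum_mul_arr g, hwg g hg, smul_zero, neg_zero]
    · simp only [sub_mul, Finset.sum_sub_distrib, smul_mul_assoc, ← Finset.smul_sum]
      rw [Finset.sum_mul] at hwx
      rw [hwx, smul_zero, sub_zero, Finset.sum_eq_single f]
      · rw [Pi.single_eq_same, Q.e_arr]
      · intro g _ hg
        rw [Pi.single_eq_of_ne hg, zero_mul, zero_mul]
      · exact fun h => absurd (Finset.mem_univ _) h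
  have harr : ∀ f : Quiver.Costar j, Q.arr f.2 * x = 0 := by
    intro f
    obtain ⟨r, hr, hr'⟩ := Q.exists_pow_left x key n f
    rw [hr']
    refine Finset.sum_eq_zero fun g _ => ?_
    have := hr g
    rw [hn, Submodule.mem_bot] at this
    rw [this, zero_mul, zero_mul]
  obtain ⟨q, hq⟩ := Q.last j y (hy j)
  rw [← hx, ← mul_assoc, hq, Finset.sum_mul]
  exact Finset.sum_eq_zero fun f _ => by rw [mul_assoc, harr, mul_zero]

/-- If the right annihilator of `x` contains a perturbation of every arrow which starts at `j`,
then it contains `e j * rad`. -/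
theorem mul_rad_eq_zero {n : ℕ} (hn : Q.rad ^ n = ⊥) {j : V} {x : A} (hx : x * Q.e j = x)
    (h : ∀ f : Quiver.Star j, ∃ w : A, x * w = 0 ∧ Q.e j * w = w ∧ w ∈ Q.rad ∧ Q.D f.2 w ≠ 0 ∧
      ∀ g, g ≠ f → Q.D g.2 w = 0) {y : A} (hy : y ∈ Q.rad) : x * y = 0 := by
  classical
  have key : ∀ f : Quiver.Star j, ∃ r : Quiver.Star j → A, (∀ g, r g ∈ Q.rad) ∧
      x * Q.arr f.2 = ∑ g, x * (Q.arr g.2 * r g) := by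
    intro f
    obtain ⟨w, hwx, hwe, hw, hwf, hwg⟩ := h f
    obtain ⟨q, hq, rfl⟩ := Q.exists_first hwe (hw j)
    rw [Q.D_sum_arr_mul] at hwf
    refine ⟨fun g => (Pi.single f (Q.e f.1) : Quiver.Star j → A) g - (Q.χ f.1 (q f))⁻¹ • q g,
      fun g => ?_, ?_⟩
    · by_cases hg : g = f
      · subst hg
        beta_reduce
        rw [Pi.single_eq_same]
        refine Q.mem_rad_of_e_mul (a := g.1) ?_ ?_
        · rw [mul_sub, Q.idem, mul_smul_comm, hq]
        · rw [map_sub, map_smul, Q.χ_self, smul_eq_mul, inv_mul_cancel₀ hwf, sub_self]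
      · beta_reduce
        rw [Pi.single_eq_of_ne hg, zero_sub]
        refine Q.mem_rad_of_e_mul (a := g.1) ?_ ?_
        · rw [mul_neg, mul_smul_comm, hq]
        · rw [map_neg, map_smul, ← Q.D_sum_arr_mul g, hwg g hg, smul_zero, neg_zero]
    · simp only [mul_sub, Finset.sum_sub_distrib, mul_smul_comm, ← Finset.smul_sum]
      rw [Finset.mul_sum] at hwx
      rw [hwx, smul_zero, sub_zero, Finset.sum_eq_single f]
      · rw [Pi.single_eq_same, Q.arr_e]
      · intro g _ hg
        rw [Pi.single_eq_of_ne hg, mul_zero, mul_zero]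
      · exact fun h => absurd (Finset.mem_univ _) h
  have harr : ∀ f : Quiver.Star j, x * Q.arr f.2 = 0 := by
    intro f
    obtain ⟨r, hr, hr'⟩ := Q.exists_pow_right x key n f
    rw [hr']
    refine Finset.sum_eq_zero fun g _ => ?_
    have := hr g
    rw [hn, Submodule.mem_bot] at this
    rw [this, mul_zero, mul_zero]
  obtain ⟨q, hq⟩ := Q.first j y (hy j)
  rw [← hx, mul_assoc, hq, Finset.mul_sum]
  exact Finset.sum_eq_zero fun f _ => by rw [← mul_assoc, harr, zero_mul]

/-- In a symmetric algebra, an arrow which is not a loop is not annihilated by the radical. -/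
theorem not_annihilates_arrow (hsymm : IsSymmAlgebra K A) {i j : V} (f : i ⟶ j) (hij : i ≠ j)
    (h : (∀ y ∈ Q.rad, Q.arr f * y = 0) ∨ ∀ y ∈ Q.rad, y * Q.arr f = 0) : False := by
  have h0 : Q.arr f = 0 := by
    refine hsymm.eq_zero_of_forall Q.e Q.rad (fun a => ⟨fun b => Q.χ b a, fun b => ?_⟩) _
      (fun b => ?_) Q.idem h
    · rw [map_sub, map_sum, Finset.sum_eq_single b]
      · rw [map_smul, Q.χ_self, smul_eq_mul, mul_one, sub_self]
      · intro c _ hc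
        rw [map_smul, Q.χ_ne hc, smul_zero]
      · exact fun h => absurd (Finset.mem_univ _) h
    -- An arrow between distinct vertices has no component in any `e_b A e_b`.
    · by_cases hb : b = i
      · rw [hb, Q.e_arr, ← Q.arr_e, mul_assoc, Q.orth (Ne.symm hij), mul_zero]
      · rw [← Q.e_arr, ← mul_assoc, Q.orth hb, zero_mul, zero_mul]
  have h1 := Q.D_self f
  rw [h0, map_zero] at h1
  exact zero_ne_one h1

/-- At a vertex with a single arrow `α` ending at it, a relation containing `αβ` gives an element
of the left annihilator of `α` which is a perturbation of an arrow. -/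
theorem exists_left_annihilator {j i k : V} (α : j ⟶ i) (β : i ⟶ k)
    (hα : ∀ f : Quiver.Costar i, f = ⟨j, α⟩) {φ : Quiver.Star k → Quiver.Costar k → A}
    (hφ : Q.IsRelationMatrix k φ)
    {q : Quiver.Costar k → A} (hq : Q.IsRelation q) (hD : Q.D α (q ⟨i, β⟩) ≠ 0) :
    ∃ (δ : k ⟶ j) (w : A), w * Q.arr α = 0 ∧ w * Q.e j = w ∧ w ∈ Q.rad ∧ Q.D δ w ≠ 0 ∧
      Q.e k * w = w := by
  obtain ⟨δ, hδ⟩ := hφ.exists_arrow α β hq hD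
  -- As `α` is the only arrow ending at `i`, every entry of the column `β` is a left multiple of
  -- `α`; cancelling `α` turns the column relation into `w α = 0`.
  have key : ∀ g, ∃ s : A, φ g ⟨i, β⟩ = s * Q.arr α := by
    intro g
    obtain ⟨r, -, hr⟩ := Q.exists_last ((hφ.rel g).1 ⟨i, β⟩) ((hφ.rel g).mem_rad ⟨i, β⟩ i)
    refine ⟨r ⟨j, α⟩, ?_⟩
    rw [hr, Finset.sum_eq_single ⟨j, α⟩]
    · exact fun f _ hf => absurd (hα f) hf
    · exact fun h => absurd (Finset.mem_univ _) h
  choose s hs using key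
  have hwα : (∑ g, Q.arr g.2 * s g) * Q.arr α = 0 := by
    rw [← hφ.dual ⟨i, β⟩, Finset.sum_mul]
    exact Finset.sum_congr rfl fun g _ => by rw [hs, mul_assoc]
  refine ⟨δ, (∑ g, Q.arr g.2 * s g) * Q.e j, ?_, ?_, fun a => ?_, ?_, ?_⟩
  · rw [mul_assoc, Q.e_arr, hwα]
  · rw [mul_assoc, Q.idem]
  · rw [map_mul, map_sum, Finset.sum_eq_zero, zero_mul]
    exact fun g _ => by rw [map_mul, Q.χ_arr, zero_mul]
  · rw [Q.D_mul_e, Q.D_sum_arr_mul ⟨j, δ⟩]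
    rwa [hs, Q.D_mul_arr] at hδ
  · rw [← mul_assoc, Finset.mul_sum]
    congr 1
    exact Finset.sum_congr rfl fun g _ => by rw [← mul_assoc, Q.e_arr]

/-! ### The two types of non-regular vertices. -/

/-- The path `αβ` occurs in a relation. -/
def Occurs {a b c : V} (α : a ⟶ b) (β : b ⟶ c) : Prop :=
  ∃ q : Quiver.Costar c → A, Q.IsRelation q ∧ Q.D α (q ⟨b, β⟩) ≠ 0

/-- There is no vertex `i` with a single arrow `α` ending at it and arrows `β`, `β'` to different
targets such that `αβ` and `αβ'` occur in relations. -/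
theorem not_occurs_oneTwo [FiniteDimensional K A] (hsymm : IsSymmAlgebra K A)
    (hper : IsPeriodicAlgebra K A 4) {n : ℕ} (hn : Q.rad ^ n = ⊥) {i j k l : V} (α : j ⟶ i)
    (hα : ∀ f : Quiver.Costar i, f = ⟨j, α⟩) (hj : Nat.card (Quiver.Costar j) ≤ 2)
    (β : i ⟶ k) (β' : i ⟶ l) (hkl : k ≠ l) (h : Q.Occurs α β) (h' : Q.Occurs α β') : False := by
  obtain ⟨q, hq, hD⟩ := h
  obtain ⟨q', hq', hD'⟩ := h'
  obtain ⟨φ, hφ⟩ := Q.exists_isRelationMatrix hsymm hper hn k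
  obtain ⟨φ', hφ'⟩ := Q.exists_isRelationMatrix hsymm hper hn l
  obtain ⟨δ, w, hw₁, hw₂, hw₃, hw₄, hw₅⟩ := Q.exists_left_annihilator α β hα hφ hq hD
  obtain ⟨δ', w', hw₁', hw₂', hw₃', hw₄', hw₅'⟩ := Q.exists_left_annihilator α β' hα hφ' hq' hD'
  have hne : (⟨k, δ⟩ : Quiver.Costar j) ≠ ⟨l, δ'⟩ := fun h => hkl (congrArg Sigma.fst h)
  -- Two distinct arrows end at `j`, but only one ends at `i`.
  have hji : j ≠ i := by
    rintro rfl
    exact hne ((hα _).trans (hα _).symm)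
  have hcases : ∀ f : Quiver.Costar j, f = ⟨k, δ⟩ ∨ f = ⟨l, δ'⟩ := by
    classical
    intro f
    by_contra! hf
    rw [Nat.card_eq_fintype_card] at hj
    have h3 := Finset.card_le_univ ({f, ⟨k, δ⟩, ⟨l, δ'⟩} : Finset (Quiver.Costar j))
    rw [Finset.card_eq_three.2 ⟨f, _, _, hf.1, hf.2, hne, rfl⟩] at h3
    omega
  refine Q.not_annihilates_arrow hsymm α hji (Or.inr fun y hy =>
    Q.rad_mul_eq_zero hn (Q.e_arr α) (fun f => ?_) hy)
  rcases hcases f with rfl | rfl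
  · refine ⟨w, hw₁, hw₂, hw₃, hw₄, fun g hg => ?_⟩
    obtain rfl := (hcases g).resolve_left hg
    -- Properness is what separates the two perturbations: `w` starts at `k` and `δ'` at `l`.
    exact Q.D_of_e_mul_ne δ' hw₅ hkl
  · refine ⟨w', hw₁', hw₂', hw₃', hw₄', fun g hg => ?_⟩
    obtain rfl := (hcases g).resolve_right hg
    exact Q.D_of_e_mul_ne δ hw₅' (Ne.symm hkl)

/-- There is no vertex `i` with a single arrow `β` starting at it and arrows `α`, `α'` from
different sources ending at it such that `αβ` and `α'β` occur in relations. -/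
theorem not_occurs_twoOne [FiniteDimensional K A] (hsymm : IsSymmAlgebra K A)
    (hper : IsPeriodicAlgebra K A 4) {n : ℕ} (hn : Q.rad ^ n = ⊥) {i j k l : V} (β : i ⟶ j)
    (hβ : ∀ f : Quiver.Star i, f = ⟨j, β⟩) (hj : Nat.card (Quiver.Star j) ≤ 2)
    (α : k ⟶ i) (α' : l ⟶ i) (hkl : k ≠ l)
    (h : Q.Occurs α β) (h' : Q.Occurs α' β) : False := by
  classical
  obtain ⟨q, hq, hD⟩ := h
  obtain ⟨q', hq', hD'⟩ := h'
  obtain ⟨φ, hφ⟩ := Q.exists_isRelationMatrix hsymm hper hn j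
  obtain ⟨ψ, hψ⟩ := Q.exists_isRelationMatrix hsymm hper hn i
  obtain ⟨δ, hδ⟩ := hφ.exists_arrow α β hq hD
  obtain ⟨δ', hδ'⟩ := hφ.exists_arrow α' β hq' hD'
  have hne : (⟨k, δ⟩ : Quiver.Star j) ≠ ⟨l, δ'⟩ := fun h => hkl (congrArg Sigma.fst h)
  have hij : i ≠ j := by
    rintro rfl
    exact hne ((hβ _).trans (hβ _).symm)
  have hcases : ∀ f : Quiver.Star j, f = ⟨k, δ⟩ ∨ f = ⟨l, δ'⟩ := by
    intro f
    by_contra! hf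
    rw [Nat.card_eq_fintype_card] at hj
    have h3 := Finset.card_le_univ ({f, ⟨k, δ⟩, ⟨l, δ'⟩} : Finset (Quiver.Star j))
    rw [Finset.card_eq_three.2 ⟨f, _, _, hf.1, hf.2, hne, rfl⟩] at h3
    omega
  -- rewrite the relation `∑ arr g * φ g β = 0` as a relation at `i`
  choose r hre hr using fun g =>
    Q.exists_last ((hφ.rel g).1 ⟨i, β⟩) ((hφ.rel g).mem_rad ⟨i, β⟩ i)
  have hrel : Q.IsRelation (fun f : Quiver.Costar i => ∑ g, Q.arr g.2 * r g f) := by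
    refine ⟨fun f => ?_, ?_⟩
    · rw [Finset.sum_mul]
      exact Finset.sum_congr rfl fun g _ => by rw [mul_assoc, hre]
    · rw [← hφ.dual ⟨i, β⟩]
      simp only [Finset.sum_mul]
      rw [Finset.sum_comm]
      refine Finset.sum_congr rfl fun g _ => ?_
      rw [hr g, Finset.mul_sum]
      simp only [mul_assoc]
  -- Only `β` starts at `i`, so the matrix at `i` has a single row, and the rewritten relation is `c
  -- ⟨j, β⟩` times that row.
  obtain ⟨c, hc⟩ := hψ.gen _ hrel
  have hsum : ∀ F : Quiver.Star i → A, ∑ g, F g = F ⟨j, β⟩ := fun F =>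
    Finset.sum_eq_single _ (fun g _ hg => absurd (hβ g) hg)
      fun h => absurd (Finset.mem_univ _) h
  -- Comparing coefficients of an arrow `g` starting at `j`, the linear part of the row is, up to
  -- the scalar `χ j (c ⟨j, β⟩)`, the matrix of constant terms of the `r g f`.
  have hDψ : ∀ (g : Quiver.Star j) (f : Quiver.Costar i),
      Q.χ g.1 (r g f) = Q.χ j (c ⟨j, β⟩) * Q.D g.2 (ψ ⟨j, β⟩ f) := by
    intro g f
    have h1 := hc f
    rw [hsum] at h1
    rw [← Q.D_sum_arr_mul g fun g => r g f, h1, Q.D_mul, (hψ.rel _).mem_rad f, mul_zero, add_zero]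
  -- With a single row, the column relation at `i` has the single term displayed here.
  have hβψ : ∀ f, Q.arr β * ψ ⟨j, β⟩ f = 0 := fun f => by rw [← hψ.dual f, hsum]
  have hχ₁ : Q.χ k (r ⟨k, δ⟩ ⟨k, α⟩) ≠ 0 := by
    rw [← Q.D_sum_mul_arr ⟨k, α⟩, ← hr]
    exact hδ
  have hχ₂ : Q.χ l (r ⟨l, δ'⟩ ⟨l, α'⟩) ≠ 0 := by
    rw [← Q.D_sum_mul_arr ⟨l, α'⟩, ← hr]
    exact hδ'
  have hcj : Q.χ j (c ⟨j, β⟩) ≠ 0 := by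
    have := hDψ ⟨k, δ⟩ ⟨k, α⟩
    exact left_ne_zero_of_mul (this ▸ hχ₁)
  refine Q.not_annihilates_arrow hsymm β hij (Or.inl fun y hy =>
    Q.mul_rad_eq_zero hn (Q.arr_e β) (fun f => ?_) hy)
  rcases hcases f with rfl | rfl
  · refine ⟨ψ ⟨j, β⟩ ⟨k, α⟩, hβψ _, hψ.e_mul ⟨j, β⟩ _, (hψ.rel _).mem_rad _, ?_, fun g hg => ?_⟩
    · exact right_ne_zero_of_mul (hDψ ⟨k, δ⟩ ⟨k, α⟩ ▸ hχ₁)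
    · obtain rfl := (hcases g).resolve_left hg
      have := hDψ ⟨l, δ'⟩ ⟨k, α⟩
      -- The coefficient `r ⟨l, δ'⟩ ⟨k, α⟩` ends at `k ≠ l`, so its constant term at `l` is zero.
      rw [Q.χ_of_mul_e_ne (hre _ _) hkl, eq_comm, mul_eq_zero] at this
      exact this.resolve_left hcj
  · refine ⟨ψ ⟨j, β⟩ ⟨l, α'⟩, hβψ _, hψ.e_mul ⟨j, β⟩ _, (hψ.rel _).mem_rad _, ?_, fun g hg => ?_⟩
    · exact right_ne_zero_of_mul (hDψ ⟨l, δ'⟩ ⟨l, α'⟩ ▸ hχ₂)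
    · obtain rfl := (hcases g).resolve_right hg
      have := hDψ ⟨k, δ⟩ ⟨l, α'⟩
      rw [Q.χ_of_mul_e_ne (hre _ _) (Ne.symm hkl), eq_comm, mul_eq_zero] at this
      exact this.resolve_left hcj

end QuiverCoordinates

/-! ### Admissible quotients of path algebras -/

namespace PathAlgebra

variable {K : Type u} {V : Type v} [Field K] [Fintype V] [Quiver.{w} V]
  {I : Ideal (PathAlgebra K V)} [I.IsTwoSided]

/-- The coefficient of a trivial path, on an admissible quotient. -/
noncomputable def quotientChar (hI : I.restrictScalars K ≤ arrowIdeal K V ^ 2) (a : V) :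
    (PathAlgebra K V ⧸ I) →ₐ[K] K :=
  Ideal.Quotient.liftₐ I
    (AlgHom.ofLinearMap (vertexCoeff K a) (vertexCoeff_one a) (vertexCoeff_mul a))
    fun _ hx => (coeff_eq_zero_of_mem_sq (hI hx)).1 a

/-- The coefficient of an arrow, on an admissible quotient. -/
noncomputable def quotientArrowCoeff (hI : I.restrictScalars K ≤ arrowIdeal K V ^ 2) {a b : V}
    (f : a ⟶ b) : (PathAlgebra K V ⧸ I) →ₗ[K] K :=
  ((I.restrictScalars K).liftQ (arrowCoeff K f)
    fun _ hx => (coeff_eq_zero_of_mem_sq (hI hx)).2 f).comp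
    (Submodule.Quotient.restrictScalarsEquiv K I).symm.toLinearMap

theorem quotientChar_mk (hI : I.restrictScalars K ≤ arrowIdeal K V ^ 2) (a : V)
    (x : PathAlgebra K V) : quotientChar hI a (Ideal.Quotient.mk I x) = vertexCoeff K a x := rfl

variable [∀ a b : V, Finite (a ⟶ b)]

/-- The coordinates of an admissible quotient of a path algebra. -/
noncomputable def quotientCoordinates (hI : I.restrictScalars K ≤ arrowIdeal K V ^ 2) :
    QuiverCoordinates K V (PathAlgebra K V ⧸ I) where
  e a := Ideal.Quotient.mk I (vertexIdem K a)
  arr f := Ideal.Quotient.mk I (ofPath K f.toPath)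
  χ := quotientChar hI
  D := quotientArrowCoeff hI
  idem a := by rw [← map_mul, vertexIdem, ofPath_mul_ofPath, Quiver.Path.comp_nil]
  orth h := by rw [← map_mul, vertexIdem, vertexIdem, ofPath_mul_ofPath_of_ne _ _ h, map_zero]
  e_arr f := by rw [← map_mul, vertexIdem, ofPath_mul_ofPath, Quiver.Path.nil_comp]
  arr_e f := by rw [← map_mul, vertexIdem, ofPath_mul_ofPath, Quiver.Path.comp_nil]
  χ_self a := vertexCoeff_vertexIdem_self a
  χ_ne h := vertexCoeff_vertexIdem_of_ne h
  χ_arr c a b f := vertexCoeff_cons c _ _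
  D_mul f x y := by
    obtain ⟨x, rfl⟩ := Ideal.Quotient.mk_surjective x
    obtain ⟨y, rfl⟩ := Ideal.Quotient.mk_surjective y
    rw [← map_mul]
    exact arrowCoeff_mul f x y
  D_e f c := arrowCoeff_nil f
  D_self f := arrowCoeff_self f
  D_costar h := arrowCoeff_costar_of_ne h
  D_star h := arrowCoeff_star_of_ne h
  last a x hx := by
    obtain ⟨x, rfl⟩ := Ideal.Quotient.mk_surjective x
    rw [quotientChar_mk] at hx
    obtain ⟨q, hq, -⟩ := exists_last_arrow a x
    refine ⟨fun f => Ideal.Quotient.mk I (q f), ?_⟩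
    rw [← map_mul, hq, hx, zero_smul, zero_add, map_sum]
    simp only [map_mul]
  first a x hx := by
    obtain ⟨x, rfl⟩ := Ideal.Quotient.mk_surjective x
    rw [quotientChar_mk] at hx
    obtain ⟨q, hq⟩ := exists_first_arrow a x
    refine ⟨fun f => Ideal.Quotient.mk I (q f), ?_⟩
    rw [← map_mul, hq, hx, zero_smul, zero_add, map_sum]
    simp only [map_mul]

/-- The radical of the quotient is the image of the arrow ideal; products of lifts then handle the
powers, so admissibility makes the radical nilpotent. -/
theorem exists_lift_of_mem_rad_pow (hI : I.restrictScalars K ≤ arrowIdeal K V ^ 2) (n : ℕ) :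
    ∀ x ∈ (quotientCoordinates hI).rad ^ (n + 1),
      ∃ y ∈ arrowIdeal K V ^ (n + 1), Ideal.Quotient.mk I y = x := by
  induction n with
  | zero =>
    intro x hx
    rw [zero_add, Submodule.pow_one] at hx
    obtain ⟨y, rfl⟩ := Ideal.Quotient.mk_surjective x
    exact ⟨y, by rw [zero_add, pow_one]; exact mem_arrowIdeal_of_vertexCoeff hx, rfl⟩
  | succ n ih =>
    intro x hx
    rw [Ideal.IsTwoSided.pow_succ] at hx
    induction hx using Submodule.mul_induction_on' with
    | mem_mul_mem x hx y hy =>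
      obtain ⟨x, rfl⟩ := Ideal.Quotient.mk_surjective x
      obtain ⟨y, hy', rfl⟩ := ih y hy
      refine ⟨x * y, ?_, map_mul _ _ _⟩
      rw [pow_succ']
      exact Submodule.mul_mem_mul (mem_arrowIdeal_of_vertexCoeff hx) hy'
    | add x _ y _ hx hy =>
      obtain ⟨x, hx, rfl⟩ := hx
      obtain ⟨y, hy, rfl⟩ := hy
      exact ⟨x + y, add_mem hx hy, map_add _ _ _⟩

theorem rad_pow_eq_bot (hI : I.restrictScalars K ≤ arrowIdeal K V ^ 2) {n : ℕ}
    (hn : arrowIdeal K V ^ (n + 1) ≤ I.restrictScalars K) :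
    (quotientCoordinates hI).rad ^ (n + 1) = ⊥ := by
  refine eq_bot_iff.2 fun x hx => ?_
  obtain ⟨y, hy, rfl⟩ := exists_lift_of_mem_rad_pow hI n x hx
  exact Ideal.Quotient.eq_zero_iff_mem.2 (hn hy)

theorem finiteDimensional_quotient {n : ℕ}
    (hn : arrowIdeal K V ^ (n + 1) ≤ I.restrictScalars K) :
    FiniteDimensional K (PathAlgebra K V ⧸ I) := by
  obtain ⟨W, hW, hW'⟩ := exists_finite_complement (K := K) (V := V) n
  refine Module.Finite.of_surjective ((Ideal.Quotient.mkₐ K I).toLinearMap.comp W.subtype)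
    fun x => ?_
  obtain ⟨x, rfl⟩ := Ideal.Quotient.mk_surjective x
  have hx : x ∈ W ⊔ arrowIdeal K V ^ (n + 1) := hW' ▸ Submodule.mem_top
  obtain ⟨y, hy, z, hz, rfl⟩ := Submodule.mem_sup.1 hx
  refine ⟨⟨y, hy⟩, ?_⟩
  rw [map_add, Ideal.Quotient.eq_zero_iff_mem.2 (hn hz), add_zero]
  rfl

theorem OccursIn.occurs {hI : I.restrictScalars K ≤ arrowIdeal K V ^ 2} {a b c : V} {α : a ⟶ b}
    {β : b ⟶ c} (h : OccursIn (α.toPath.comp β.toPath) I) :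
    (quotientCoordinates hI).Occurs α β := by
  obtain ⟨ρ, ⟨hρ, -, -⟩, hc⟩ := h
  -- Splitting off last arrows turns `ρ` into a left relation between the arrows ending at `c`; the
  -- coefficient of `αβ` in `ρ` is the coefficient of `α` in the component of `β`.
  obtain ⟨q, hq, hq'⟩ := exists_last_arrow c ρ
  rw [(coeff_eq_zero_of_mem_sq (hI hρ)).1 c, zero_smul, zero_add] at hq
  refine ⟨fun f => Ideal.Quotient.mk I (q f * vertexIdem K f.1), ⟨fun f => ?_, ?_⟩, ?_⟩
  · refine (map_mul _ _ _).symm.trans ?_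
    rw [mul_assoc, vertexIdem, ofPath_mul_ofPath, Quiver.Path.comp_nil]
    rfl
  · have h0 : Ideal.Quotient.mk I (ρ * vertexIdem K c) = 0 :=
      Ideal.Quotient.eq_zero_iff_mem.2 (I.mul_mem_right _ hρ)
    rw [hq, map_sum] at h0
    rw [← h0]
    refine Finset.sum_congr rfl fun f _ => (map_mul _ _ _).symm.trans ?_
    rw [mul_assoc, vertexIdem, ofPath_mul_ofPath, Quiver.Path.nil_comp]
  · change arrowCoeff K α (q ⟨b, β⟩ * vertexIdem K b) ≠ 0
    rw [arrowCoeff_mul, vertexCoeff_vertexIdem_self, mul_one, vertexIdem, arrowCoeff_nil, mul_zero,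
      zero_add]
    exact (hq' ⟨b, β⟩ a α.toPath).trans_ne hc

end PathAlgebra

theorem lemma5p2 {K : Type u} [Field K] [IsAlgClosed K]
    {V : Type v} [Fintype V] [Quiver.{w} V] [∀ a b : V, Finite (a ⟶ b)]
    (hconn : Quiver.IsConnectedQuiver V) (hbis : Quiver.IsBiserial V)
    (I : Ideal (PathAlgebra K V)) [I.IsTwoSided] (hadm : PathAlgebra.IsAdmissible I)
    (htame : IsTameAlgebra K (PathAlgebra K V ⧸ I))
    (hsymm : IsSymmAlgebra K (PathAlgebra K V ⧸ I))
    (hper : IsPeriodicAlgebra K (PathAlgebra K V ⧸ I) 4) :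
    ¬ ∃ i : V, ¬ Quiver.IsRegularVertex i ∧ Quiver.IsProperVertex i ∧ Quiver.IsTypeR I i := by
  rintro ⟨i, -, hprop, -, hR⟩
  obtain ⟨m, hm, hmI, hI⟩ := hadm
  -- The nilpotency statements use the exponent `n + 1`, since the zeroth power is not contained in
  -- the radical.
  obtain ⟨n, rfl⟩ : ∃ n, m = n + 1 := ⟨m - 1, by omega⟩
  have := PathAlgebra.finiteDimensional_quotient hmI
  have hn := PathAlgebra.rad_pow_eq_bot hI hmI
  rcases hprop with ⟨⟨h1, h2⟩, hp⟩ | ⟨⟨h2, h1⟩, hp⟩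
  · obtain ⟨β, β', hne, -⟩ := Nat.card_eq_two_iff.1 h2
    obtain ⟨_, ⟨α⟩⟩ := Nat.card_eq_one_iff_unique.1 h1
    exact (PathAlgebra.quotientCoordinates hI).not_occurs_oneTwo hsymm hper hn α.2
      (fun f => Subsingleton.elim f α) (hbis α.1).2 β.2 β'.2 (hp β β' hne)
      (hR α β).occurs (hR α β').occurs
  · obtain ⟨α, α', hne, -⟩ := Nat.card_eq_two_iff.1 h2
    obtain ⟨_, ⟨β⟩⟩ := Nat.card_eq_one_iff_unique.1 h1
    exact (PathAlgebra.quotientCoordinates hI).not_occurs_twoOne hsymm hper hn β.2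
      (fun f => Subsingleton.elim f β) (hbis β.1).1 α.2 α'.2 (hp α α' hne)
      (hR α β).occurs (hR α' β).occurs
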